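/- \textbf{Setting.} Let $G$ be a Fréchet Lie group, that is, a Lie group modelled on a (possibly infinite dimensional) complete Hausdorff locally convex real topological vector space; smoothness of maps between such spaces is meant in the sense of Michal--Bastiani. Let $Y$ be a smooth manifold of dimension $d$ (finite, $d\ge 0$). For $n\ge 0$ let $\Delta^n=\{x\in\mathbb R^n : x_i\ge 0,\ \sum_i x_i\le 1\}$. A map on a subset of $\mathbb R^n$ (such as $\Delta^n$) is called smooth if near every point it extends to a smooth map on an open subset of $\mathbb R^n$. Let $\Delta^{sm}$ be the category of the simplices $\Delta^n$, $n\ge0$, and smooth maps between them. A smooth simplicial set is a functor $X:(\Delta^{sm})^{op}\to \mathrm{Set}$; $\Delta^d_\bullet$ denotes the one represented by $\Delta^d$, and $Y_\bullet=\mathrm{Sing}^{sm}(Y)$ the one whose $n$-simplices are the smooth maps $\Delta^n\to Y$. The category $\Delta^{sm}(X)$ has as objects the maps $\Sigma:\Delta^d_\bullet\to X$ ($d\geq 0$; the $d$-simplices of $X$), and as morphisms $\Sigma_1\to\Sigma_2$ (of degrees $k$ and $d$) the smooth maps $f:\Delta^k\to\Delta^d$ with $\Sigma_2\circ f_\bullet=\Sigma_1$.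 A smooth simplicial $G$-bundle $P$ over $X$ is a functor from $\Delta^{sm}(X)$ to the category of smooth principal $G$-bundles and smooth $G$-bundle maps which assigns to every $d$-simplex $\Sigma$ a smooth principal $G$-bundle $P_\Sigma$ over $\Delta^d$, and to every morphism $f:\Sigma_1\to\Sigma_2$ a smooth $G$-bundle map $P_{\Sigma_1}\to P_{\Sigma_2}$ over the underlying map $f:\Delta^k\to\Delta^d$. An isomorphism of simplicial $G$-bundles over $X$ is a natural isomorphism of functors all of whose components are smooth $G$-bundle maps over the identity of $\Delta^d$. A smooth principal $G$-bundle $N\to Y$ induces a simplicial $G$-bundle $N_\bullet$ over $Y_\bullet$: $N_\bullet(\Sigma)=\Sigma^*N$, with a morphism $f:\Sigma_1\to\Sigma_2$ sent to the natural map $\Sigma_1^*N=f^*\Sigma_2^*N\to\Sigma_2^*N$. \textbf{Theorem.} For every smooth simplicial $G$-bundle $P$ over $Y_\bullet$ there exist a smooth principal $G$-bundle $N\to Y$ and an isomorphism $N_\bullet\to P$ of simplicial $G$-bundles over $Y_\bullet$. -/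

import Mathlib

open scoped Manifold ContDiff Topology
open Set Filter CategoryTheory

universe u v w u' v'

/-- `f` is of class `C^k` on the open set `U`, in the sense of Michal and Bastiani, where `E` and
`F` are topological vector spaces: `f` is continuous and, if `k > 0`, all directional derivatives
`df (x, v) = lim_{t → 0} (f (x + t v) - f x) / t` exist for `x ∈ U`, and `df` is of class
`C^(k-1)` on `U × E`. -/
def IsCkOn {F : Type v} [AddCommGroup F] [Module ℝ F] [TopologicalSpace F] :
    ℕ → ∀ {E : Type u} [AddCommGroup E] [Module ℝ E] [TopologicalSpace E],
      (E → F) → Set E → Prop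
  | 0, _, _, _, _, f, U => ContinuousOn f U
  | k + 1, E, _, _, _, f, U => ContinuousOn f U ∧ ∃ df : E × E → F,
      (∀ x ∈ U, ∀ v : E, Tendsto (fun t : ℝ => t⁻¹ • (f (x + t • v) - f x)) (𝓝[≠] 0)
        (𝓝 (df (x, v)))) ∧
      IsCkOn k df (U ×ˢ univ)

/-- Smoothness (`C^∞`) on an open set, in the sense of Michal and Bastiani. -/
def IsSmoothOn {E : Type u} {F : Type v} [AddCommGroup E] [Module ℝ E] [TopologicalSpace E]
    [AddCommGroup F] [Module ℝ F] [TopologicalSpace F] (f : E → F) (U : Set E) : Prop :=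
  ∀ k : ℕ, IsCkOn k f U

section Calculus

variable {E : Type u} {F : Type v} {H : Type w}
  [AddCommGroup E] [Module ℝ E] [TopologicalSpace E]
  [AddCommGroup F] [Module ℝ F] [TopologicalSpace F]
  [AddCommGroup H] [Module ℝ H] [TopologicalSpace H]

theorem IsCkOn.continuousOn {k : ℕ} {f : E → F} {U : Set E} (h : IsCkOn k f U) :
    ContinuousOn f U := by
  cases k with
  | zero => exact h
  | succ k => exact h.1

theorem IsCkOn.of_succ {k : ℕ} {E : Type u} [AddCommGroup E] [Module ℝ E] [TopologicalSpace E]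
    {f : E → F} {U : Set E} (h : IsCkOn (k + 1) f U) : IsCkOn k f U := by
  induction k generalizing E with
  | zero => exact h.1
  | succ k ih =>
    obtain ⟨hc, df, h1, h2⟩ := h
    exact ⟨hc, df, h1, ih h2⟩

theorem IsCkOn.mono {k : ℕ} {E : Type u} [AddCommGroup E] [Module ℝ E] [TopologicalSpace E]
    {f : E → F} {U V : Set E} (h : IsCkOn k f U) (hV : V ⊆ U) : IsCkOn k f V := by
  induction k generalizing E with
  | zero => exact ContinuousOn.mono h hV
  | succ k ih =>
    obtain ⟨hc, df, h1, h2⟩ := h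
    exact ⟨hc.mono hV, df, fun x hx => h1 x (hV hx), ih h2 (prod_mono_left hV)⟩

theorem eventually_line_mem [ContinuousAdd E] [ContinuousSMul ℝ E] {U : Set E} (hU : IsOpen U)
    {x : E} (hx : x ∈ U) (v : E) : ∀ᶠ t : ℝ in 𝓝[≠] 0, x + t • v ∈ U := by
  have : Continuous (fun t : ℝ => x + t • v) := by fun_prop
  exact nhdsWithin_le_nhds (this.continuousAt.preimage_mem_nhds (hU.mem_nhds (by simpa using hx)))

theorem IsCkOn.congr {k : ℕ} {E : Type u} [AddCommGroup E] [Module ℝ E] [TopologicalSpace E]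
    [ContinuousAdd E] [ContinuousSMul ℝ E]
    {f g : E → F} {U : Set E} (hU : IsOpen U) (h : IsCkOn k f U) (hfg : EqOn f g U) :
    IsCkOn k g U := by
  cases k with
  | zero => exact ContinuousOn.congr h hfg.symm
  | succ k =>
    obtain ⟨hc, df, h1, h2⟩ := h
    refine ⟨hc.congr hfg.symm, df, fun x hx v => (h1 x hx v).congr' ?_, h2⟩
    filter_upwards [eventually_line_mem hU hx v] with t ht
    rw [hfg ht, hfg hx]

/-- Being of class `C^k` is a local property. -/
theorem IsCkOn.of_local [T2Space F] {k : ℕ} {E : Type u} [AddCommGroup E] [Module ℝ E]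
    [TopologicalSpace E] [ContinuousAdd E] [ContinuousSMul ℝ E] {f : E → F} {U : Set E}
    (hU : IsOpen U) (h : ∀ x ∈ U, ∃ V, IsOpen V ∧ x ∈ V ∧ IsCkOn k f (U ∩ V)) :
    IsCkOn k f U := by
  induction k generalizing E with
  | zero =>
    intro x hx
    obtain ⟨V, hV, hxV, hf⟩ := h x hx
    exact (ContinuousOn.continuousAt hf ((hU.inter hV).mem_nhds ⟨hx, hxV⟩)).continuousWithinAt
  | succ k ih =>
    refine ⟨fun x hx => ?_, ?_⟩
    · obtain ⟨V, hV, hxV, hf⟩ := h x hx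
      exact (hf.1.continuousAt ((hU.inter hV).mem_nhds ⟨hx, hxV⟩)).continuousWithinAt
    · have key : ∀ z : E × E, ∃ y : F, z.1 ∈ U →
          Tendsto (fun t : ℝ => t⁻¹ • (f (z.1 + t • z.2) - f z.1)) (𝓝[≠] 0) (𝓝 y) := by
        intro z
        by_cases hz : z.1 ∈ U
        · obtain ⟨V, hV, hxV, hf, df, h1, h2⟩ := h z.1 hz
          exact ⟨_, fun _ => h1 z.1 ⟨hz, hxV⟩ z.2⟩
        · exact ⟨0, fun h => absurd h hz⟩
      choose df hdf using key
      refine ⟨df, fun x hx v => hdf (x, v) hx, ih (hU.prod isOpen_univ) ?_⟩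
      rintro ⟨x, v⟩ ⟨hx, -⟩
      obtain ⟨V, hV, hxV, hf, df', h1, h2⟩ := h x hx
      refine ⟨V ×ˢ univ, hV.prod isOpen_univ, ⟨hxV, trivial⟩, ?_⟩
      have hs : (U ×ˢ (univ : Set E)) ∩ (V ×ˢ univ) = (U ∩ V) ×ˢ univ := by
        ext z; simp
      rw [hs]
      refine h2.congr ((hU.inter hV).prod isOpen_univ) ?_
      rintro ⟨y, w⟩ ⟨hy, -⟩
      exact tendsto_nhds_unique (h1 y hy w) (hdf (y, w) hy.1)

theorem IsCkOn.prodMk {k : ℕ} {E : Type u} [AddCommGroup E] [Module ℝ E] [TopologicalSpace E]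
    {f : E → F} {g : E → H} {U : Set E} (hf : IsCkOn k f U) (hg : IsCkOn k g U) :
    IsCkOn k (fun x => (f x, g x)) U := by
  induction k generalizing E with
  | zero => exact ContinuousOn.prodMk hf hg
  | succ k ih =>
    obtain ⟨hc, df, h1, h2⟩ := hf
    obtain ⟨hc', dg, h1', h2'⟩ := hg
    exact ⟨hc.prodMk hc', fun z => (df z, dg z),
      fun x hx v => (h1 x hx v).prodMk_nhds (h1' x hx v), ih h2 h2'⟩

theorem IsCkOn.of_continuousLinearMap {k : ℕ} {E : Type u} [AddCommGroup E] [Module ℝ E]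
    [TopologicalSpace E] (L : E →L[ℝ] F) (U : Set E) : IsCkOn k L U := by
  induction k generalizing E with
  | zero => exact L.continuous.continuousOn
  | succ k ih =>
    refine ⟨L.continuous.continuousOn, L.comp (ContinuousLinearMap.snd ℝ E E), ?_, ih _ _⟩
    intro x _ v
    refine tendsto_const_nhds.congr' ?_
    filter_upwards [self_mem_nhdsWithin] with t ht
    have ht' : t ≠ 0 := ht
    simp [smul_smul, inv_mul_cancel₀ ht']

theorem IsCkOn.precomp {k : ℕ} {E E' : Type u} [AddCommGroup E] [Module ℝ E]
    [TopologicalSpace E] [AddCommGroup E'] [Module ℝ E'] [TopologicalSpace E'] {f : E → F}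
    {U : Set E} (hf : IsCkOn k f U) (L : E' →L[ℝ] E) : IsCkOn k (fun x => f (L x)) (L ⁻¹' U) := by
  induction k generalizing E E' with
  | zero => exact ContinuousOn.comp hf L.continuous.continuousOn fun _ h => h
  | succ k ih =>
    obtain ⟨hc, df, h1, h2⟩ := hf
    refine ⟨hc.comp L.continuous.continuousOn fun _ h => h, fun z => df (L z.1, L z.2),
      fun x hx v => ?_, ?_⟩
    · refine (h1 (L x) hx (L v)).congr fun t => ?_
      simp
    · refine (ih h2 (L.prodMap L)).mono ?_
      rintro z ⟨hz, -⟩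
      exact ⟨hz, trivial⟩

/-- The mean value theorem in locally convex spaces. -/
theorem sub_mem_of_deriv_mem [IsTopologicalAddGroup F] [ContinuousSMul ℝ F]
    [LocallyConvexSpace ℝ F] {c c' : ℝ → F} {K : Set F} (hK : Convex ℝ K) (hK' : IsClosed K)
    (hc : ∀ s ∈ Icc (0 : ℝ) 1,
      Tendsto (fun t : ℝ => t⁻¹ • (c (s + t) - c s)) (𝓝[≠] 0) (𝓝 (c' s)))
    (hcK : ∀ s ∈ Icc (0 : ℝ) 1, c' s ∈ K) : c 1 - c 0 ∈ K := by
  by_contra hn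
  obtain ⟨L, r, h1, h2⟩ := geometric_hahn_banach_closed_point hK hK' hn
  have hd : ∀ s ∈ Icc (0 : ℝ) 1, HasDerivAt (fun s => L (c s)) (L (c' s)) s := by
    intro s hs
    rw [hasDerivAt_iff_tendsto_slope_zero]
    refine ((L.continuous.tendsto _).comp (hc s hs)).congr fun t => ?_
    simp
  obtain ⟨s, hs, hs'⟩ := exists_hasDerivAt_eq_slope (fun s => L (c s)) (fun s => L (c' s))
    zero_lt_one (fun s hs => (hd s hs).continuousAt.continuousWithinAt)
    (fun s hs => hd s (Ioo_subset_Icc_self hs))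
  have := h1 _ (hcK s (Ioo_subset_Icc_self hs))
  rw [map_sub] at h2
  simp only [sub_zero, div_one] at hs'
  linarith

/-- A closed convex neighbourhood basis. -/
theorem exists_closed_convex_nhds [IsTopologicalAddGroup F] [ContinuousSMul ℝ F]
    [LocallyConvexSpace ℝ F] {y : F} {N : Set F} (hN : N ∈ 𝓝 y) :
    ∃ K ∈ 𝓝 y, K ⊆ N ∧ Convex ℝ K ∧ IsClosed K := by
  obtain ⟨N', hN', hcl, hsub⟩ := exists_mem_nhds_isClosed_subset hN
  obtain ⟨S, ⟨hS, hSc⟩, hSN⟩ := (LocallyConvexSpace.convex_basis (𝕜 := ℝ) y).mem_iff.1 hN'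
  exact ⟨closure S, mem_of_superset hS subset_closure,
    (closure_minimal hSN hcl).trans hsub, hSc.closure, isClosed_closure⟩

/-- The chain rule for `C^1` maps. -/
theorem tendsto_comp_slope [ContinuousAdd E] [ContinuousSMul ℝ E]
    [IsTopologicalAddGroup F] [ContinuousSMul ℝ F] [LocallyConvexSpace ℝ F]
    {f : E → F} {df : E × E → F} {U : Set E} (hU : IsOpen U)
    (h1 : ∀ x ∈ U, ∀ v : E, Tendsto (fun t : ℝ => t⁻¹ • (f (x + t • v) - f x)) (𝓝[≠] 0)
        (𝓝 (df (x, v))))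
    (h2 : ContinuousOn df (U ×ˢ univ)) {y w : E} (hy : y ∈ U) {q : ℝ → E}
    (hq : Tendsto q (𝓝[≠] 0) (𝓝 w)) :
    Tendsto (fun t : ℝ => t⁻¹ • (f (y + t • q t) - f y)) (𝓝[≠] 0) (𝓝 (df (y, w))) := by
  intro N hN
  obtain ⟨K, hK, hKN, hKc, hKcl⟩ := exists_closed_convex_nhds hN
  have hV : (fun p : ℝ × E => (y + p.1 • p.2, p.2)) ⁻¹' ((U ×ˢ univ) ∩ df ⁻¹' K)
      ∈ 𝓝 ((0 : ℝ), w) := by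
    have hc : Continuous (fun p : ℝ × E => (y + p.1 • p.2, p.2)) := by fun_prop
    refine hc.continuousAt.preimage_mem_nhds ?_
    have hm : (y, w) ∈ U ×ˢ (univ : Set E) := ⟨hy, trivial⟩
    simp only [zero_smul, add_zero]
    exact inter_mem ((hU.prod isOpen_univ).mem_nhds hm)
      ((h2.continuousAt ((hU.prod isOpen_univ).mem_nhds hm)).preimage_mem_nhds hK)
  rw [nhds_prod_eq, mem_prod_iff] at hV
  obtain ⟨T, hT, Q, hQ, hTQ⟩ := hV
  obtain ⟨δ, hδ, hδT⟩ := Metric.mem_nhds_iff.1 hT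
  have hball : ∀ᶠ t : ℝ in 𝓝[≠] 0, t ∈ Metric.ball (0 : ℝ) δ :=
    nhdsWithin_le_nhds (Metric.ball_mem_nhds _ hδ)
  have hne : ∀ᶠ t : ℝ in 𝓝[≠] 0, t ≠ 0 := self_mem_nhdsWithin
  show ∀ᶠ t : ℝ in 𝓝[≠] 0, t⁻¹ • (f (y + t • q t) - f y) ∈ N
  filter_upwards [hball, hq hQ, hne] with t ht hqt ht0
  have ht0' : t ≠ 0 := ht0
  refine hKN ?_
  have hst : ∀ s ∈ Icc (0 : ℝ) 1, (y + (s * t) • q t ∈ U) ∧ df (y + (s * t) • q t, q t) ∈ K := by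
    intro s hs
    have : (s * t, q t) ∈ T ×ˢ Q := by
      refine ⟨hδT ?_, hqt⟩
      simp only [Metric.mem_ball, dist_zero_right, norm_mul, Real.norm_eq_abs] at ht ⊢
      rw [abs_of_nonneg hs.1]
      nlinarith [hs.2, abs_nonneg t]
    have := hTQ this
    exact ⟨this.1.1, this.2⟩
  have := sub_mem_of_deriv_mem (c := fun s => t⁻¹ • f (y + (s * t) • q t))
    (c' := fun s => df (y + (s * t) • q t, q t)) hKc hKcl ?_ (fun s hs => (hst s hs).2)
  · simpa [smul_sub] using this
  · intro s hs
    have hl := h1 _ (hst s hs).1 (q t)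
    have hm : Tendsto (fun r : ℝ => r * t) (𝓝[≠] 0) (𝓝[≠] 0) := by
      refine tendsto_nhdsWithin_iff.2 ⟨?_, ?_⟩
      · have : Continuous (fun r : ℝ => r * t) := by fun_prop
        simpa using (this.tendsto 0).mono_left nhdsWithin_le_nhds
      · filter_upwards [self_mem_nhdsWithin] with r hr
        exact mul_ne_zero hr ht0'
    refine (hl.comp hm).congr fun r => ?_
    simp only [Function.comp, add_mul, add_smul, ← smul_sub, smul_smul, mul_inv, add_assoc]

/-- The composition of `C^k` maps is of class `C^k`. -/
theorem IsCkOn.comp [IsTopologicalAddGroup H] [ContinuousSMul ℝ H] [LocallyConvexSpace ℝ H]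
    {k : ℕ} {E : Type u} {F : Type v} [AddCommGroup E] [Module ℝ E] [TopologicalSpace E]
    [ContinuousAdd E] [ContinuousSMul ℝ E]
    [AddCommGroup F] [Module ℝ F] [TopologicalSpace F]
    [IsTopologicalAddGroup F] [ContinuousSMul ℝ F]
    {f : F → H} {g : E → F} {U : Set E} {V : Set F}
    (hV : IsOpen V) (hf : IsCkOn k f V) (hg : IsCkOn k g U) (hm : MapsTo g U V) :
    IsCkOn k (fun x => f (g x)) U := by
  induction k generalizing E F with
  | zero => exact ContinuousOn.comp hf hg hm
  | succ k ih =>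
    have hg' := hg.of_succ
    obtain ⟨hfc, df, hf1, hf2⟩ := hf
    obtain ⟨hgc, dg, hg1, hg2⟩ := hg
    refine ⟨hfc.comp hgc hm, fun z => df (g z.1, dg z), fun x hx v => ?_, ?_⟩
    · refine (tendsto_comp_slope hV hf1 hf2.continuousOn (hm hx) (hg1 x hx v)).congr' ?_
      filter_upwards [self_mem_nhdsWithin] with t ht
      have ht' : t ≠ 0 := ht
      simp [smul_smul, mul_inv_cancel₀ ht']
    · refine ih (g := fun z => (g z.1, dg z)) (hV.prod isOpen_univ) hf2 (IsCkOn.prodMk ?_ hg2)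
        (fun z hz => ⟨hm hz.1, trivial⟩)
      refine (hg'.precomp (ContinuousLinearMap.fst ℝ E E)).mono ?_
      rintro z ⟨hz, -⟩
      exact hz

/-- `C^∞` maps of normed spaces in the usual sense are of class `C^k`. -/
theorem IsCkOn.of_contDiffOn {F : Type v} [NormedAddCommGroup F] [NormedSpace ℝ F] {k : ℕ}
    {E : Type u} [NormedAddCommGroup E] [NormedSpace ℝ E] {f : E → F} {U : Set E}
    (hU : IsOpen U) (hf : ContDiffOn ℝ ∞ f U) : IsCkOn k f U := by
  induction k generalizing E with
  | zero => exact hf.continuousOn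
  | succ k ih =>
    refine ⟨hf.continuousOn, fun z => fderiv ℝ f z.1 z.2, fun x hx v => ?_,
      ih (hU.prod isOpen_univ) ?_⟩
    · have hd : HasFDerivAt f (fderiv ℝ f x) x :=
        ((hf.contDiffAt (hU.mem_nhds hx)).differentiableAt (by simp)).hasFDerivAt
      exact (hd.hasLineDerivAt v).tendsto_slope_zero
    · have h1 : ContDiffOn ℝ ∞ (fderiv ℝ f) U := hf.fderiv_of_isOpen hU (by simp)
      exact (h1.comp contDiffOn_fst fun z hz => hz.1).clm_apply contDiffOn_snd

end Calculus

/-! ### Fréchet Lie groups -/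

/-- `G` is a Lie group modelled on the topological vector space `E`: the changes of charts, the
multiplication and the inversion are smooth when read in charts. -/
class FrechetLieGroup (E : Type v) [AddCommGroup E] [Module ℝ E] [TopologicalSpace E]
    (G : Type w) [TopologicalSpace G] [ChartedSpace E G] [Group G] : Prop
    extends IsTopologicalGroup G where
  smooth_chart : ∀ a ∈ atlas E G, ∀ b ∈ atlas E G,
    IsSmoothOn (fun x : E => b (a.symm x)) {x | x ∈ a.target ∧ a.symm x ∈ b.source}
  smooth_mul : ∀ a ∈ atlas E G, ∀ b ∈ atlas E G, ∀ c ∈ atlas E G,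
    IsSmoothOn (fun z : E × E => c (a.symm z.1 * b.symm z.2))
      {z | z.1 ∈ a.target ∧ z.2 ∈ b.target ∧ a.symm z.1 * b.symm z.2 ∈ c.source}
  smooth_inv : ∀ a ∈ atlas E G, ∀ b ∈ atlas E G,
    IsSmoothOn (fun x : E => b (a.symm x)⁻¹) {x | x ∈ a.target ∧ (a.symm x)⁻¹ ∈ b.source}

section SmoothMaps

variable (E : Type v) [AddCommGroup E] [Module ℝ E] [TopologicalSpace E]
  {G : Type w} [TopologicalSpace G] [ChartedSpace E G]
  (n : ℕ) {M : Type u} [TopologicalSpace M] [ChartedSpace (EuclideanSpace ℝ (Fin n)) M]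

/-- A map `g : M → G` from an `n`-manifold to a manifold modelled on `E` is smooth on the open
set `W`. -/
def SmoothMapOn (g : M → G) (W : Set M) : Prop :=
  ContinuousOn g W ∧
  ∀ a ∈ atlas (EuclideanSpace ℝ (Fin n)) M, ∀ c ∈ atlas E G,
    IsSmoothOn (fun x : EuclideanSpace ℝ (Fin n) => c (g (a.symm x)))
      {x | x ∈ a.target ∧ a.symm x ∈ W ∧ g (a.symm x) ∈ c.source}

/-- Let `B` be regarded as a subspace of the manifold `M` by means of `ι : B → M`. A map
`f : B → G` is smooth on the open subset `A` of `B` if near every point of `A` it is the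
restriction of a smooth map defined on an open subset of `M`. -/
def SmoothAlong {B : Type u'} (ι : B → M) (f : B → G) (A : Set B) : Prop :=
  ∀ b ∈ A, ∃ W : Set M, IsOpen W ∧ ι b ∈ W ∧ ∃ g : M → G, SmoothMapOn E n g W ∧
    ∀ a ∈ A, ι a ∈ W → f a = g (ι a)

end SmoothMaps

/-! ### Smooth simplices and smooth simplicial sets -/

/-- The topological simplex `Δ^n = {x ∈ ℝ^n | x_i ≥ 0, x_1 + ⋯ + x_n ≤ 1}`. -/
def Simplex (n : ℕ) : Set (EuclideanSpace ℝ (Fin n)) :=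
  {x | (∀ i, 0 ≤ x i) ∧ ∑ i, x i ≤ 1}

/-- The inclusion of `Δ^n` in `ℝ^n`. -/
def simplexIncl (n : ℕ) : Simplex n → EuclideanSpace ℝ (Fin n) := Subtype.val

/-- Smoothness of a map from `Δ^n` to a smooth manifold: near every point the map extends to a
smooth map on an open subset of `ℝ^n`. -/
def SmoothOnSimplex {n : ℕ} (d : ℕ) {M : Type u} [TopologicalSpace M]
    [ChartedSpace (EuclideanSpace ℝ (Fin d)) M] (f : Simplex n → M) : Prop :=
  ∀ x : Simplex n, ∃ W : Set (EuclideanSpace ℝ (Fin n)), IsOpen W ∧ simplexIncl n x ∈ W ∧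
    ∃ g : EuclideanSpace ℝ (Fin n) → M, ContMDiffOn (𝓡 n) (𝓡 d) ∞ g W ∧
      ∀ y : Simplex n, simplexIncl n y ∈ W → f y = g (simplexIncl n y)

theorem SmoothOnSimplex.continuous {n d : ℕ} {M : Type u} [TopologicalSpace M]
    [ChartedSpace (EuclideanSpace ℝ (Fin d)) M] {f : Simplex n → M} (hf : SmoothOnSimplex d f) :
    Continuous f := by
  refine continuous_iff_continuousAt.2 fun x => ?_
  obtain ⟨W, hW, hx, g, hg, hfg⟩ := hf x
  have hι : Continuous (simplexIncl n) := continuous_subtype_val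
  have h1 : ContinuousAt (fun y => g (simplexIncl n y)) x :=
    ContinuousAt.comp (f := simplexIncl n) (g := g)
      (hg.continuousOn.continuousAt (hW.mem_nhds hx)) hι.continuousAt
  refine h1.congr ?_
  filter_upwards [hι.continuousAt.preimage_mem_nhds (hW.mem_nhds hx)] with y hy
  exact (hfg y hy).symm

theorem SmoothOnSimplex.comp {m n d : ℕ} {M : Type u} [TopologicalSpace M]
    [ChartedSpace (EuclideanSpace ℝ (Fin d)) M] {f : Simplex n → M} (hf : SmoothOnSimplex d f)
    {h : Simplex m → Simplex n} (hh : SmoothOnSimplex n (fun x => simplexIncl n (h x))) :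
    SmoothOnSimplex d (fun x => f (h x)) := by
  intro x
  obtain ⟨W, hW, hxW, g, hg, hfg⟩ := hf (h x)
  obtain ⟨W', hW', hxW', g', hg', hhg'⟩ := hh x
  refine ⟨W' ∩ g' ⁻¹' W, hg'.continuousOn.isOpen_inter_preimage hW' hW, ⟨hxW', ?_⟩,
    fun y => g (g' y), hg.comp (hg'.mono inter_subset_left) fun y hy => hy.2, ?_⟩
  · rw [mem_preimage, ← hhg' x hxW']
    exact hxW
  · rintro y ⟨hy, hy'⟩
    rw [mem_preimage, ← hhg' y hy] at hy'
    exact (hfg _ hy').trans (congrArg g (hhg' y hy))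

theorem smoothOnSimplex_incl (n : ℕ) : SmoothOnSimplex n (simplexIncl n) := fun _ =>
  ⟨univ, isOpen_univ, trivial, fun y => y, contMDiffOn_id, fun _ _ => rfl⟩

/-- The objects of the category `Δ^sm`: the simplices `Δ^dim`. -/
structure SmSimplex : Type where
  /-- The dimension. -/
  dim : ℕ

/-- The smooth maps `Δ^m → Δ^n`. -/
@[ext]
structure SmSimplexHom (m n : ℕ) : Type where
  /-- The underlying map. -/
  toFun : Simplex m → Simplex n
  smooth : SmoothOnSimplex n (fun x => simplexIncl n (toFun x))

/-- The category `Δ^sm` of simplices and smooth maps. -/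
instance : Category.{0} SmSimplex where
  Hom m n := SmSimplexHom m.dim n.dim
  id m := ⟨id, smoothOnSimplex_incl _⟩
  comp f g := ⟨fun x => g.toFun (f.toFun x), g.smooth.comp f.smooth⟩

/-- The map of simplices underlying a morphism of `Δ^sm`. -/
def SmSimplex.mapOf {m n : SmSimplex} (f : m ⟶ n) : Simplex m.dim → Simplex n.dim :=
  SmSimplexHom.toFun f

/-- A smooth simplicial set: a contravariant set-valued functor on `Δ^sm`. -/
abbrev SmoothSSet : Type (u + 1) := SmSimplexᵒᵖ ⥤ Type u

/-- The smooth simplex category `Δ^sm(X)`: its objects are the smooth maps `Δ^d_• → X`, where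
`Δ^d_•` is the smooth simplicial set represented by `Δ^d`, and its morphisms `Σ₁ → Σ₂` are the
smooth maps `f : Δ^k → Δ^d` with `Σ₂ ∘ f_• = Σ₁`. -/
abbrev SmSimplexCat (X : SmoothSSet.{u}) : Type u :=
  CostructuredArrow (uliftYoneda.{u} : SmSimplex ⥤ SmSimplexᵒᵖ ⥤ Type u) X

/-- The smooth simplicial set `Y_• = Sing^sm(Y)`: its `n`-simplices are the smooth maps
`Δ^n → Y`. -/
def singSm (d : ℕ) (Y : Type u) [TopologicalSpace Y]
    [ChartedSpace (EuclideanSpace ℝ (Fin d)) Y] : SmoothSSet.{u} where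
  obj n := {σ : Simplex n.unop.dim → Y // SmoothOnSimplex d σ}
  map f := ↾fun σ => ⟨fun x => σ.1 (SmSimplex.mapOf f.unop x), σ.2.comp f.unop.smooth⟩
  map_id _ := rfl
  map_comp _ _ := rfl

/-- The smooth map `Δ^k → Y` corresponding to an object of `Δ^sm(Y_•)`. -/
def simplexMap {d : ℕ} {Y : Type u} [TopologicalSpace Y]
    [ChartedSpace (EuclideanSpace ℝ (Fin d)) Y] (S : SmSimplexCat (singSm d Y)) :
    {σ : Simplex S.left.dim → Y // SmoothOnSimplex d σ} :=
  uliftYonedaEquiv.{u} (F := singSm d Y) S.hom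

theorem simplexMap_comp {d : ℕ} {Y : Type u} [TopologicalSpace Y]
    [ChartedSpace (EuclideanSpace ℝ (Fin d)) Y] {S T : SmSimplexCat (singSm d Y)}
    (f : S ⟶ T) (x : Simplex S.left.dim) :
    (simplexMap T).1 (SmSimplex.mapOf f.left x) = (simplexMap S).1 x := by
  have h := uliftYonedaEquiv_naturality.{u} (F := singSm d Y) T.hom f.left.op
  rw [Quiver.Hom.unop_op, CostructuredArrow.w f] at h
  exact congrFun (congrArg Subtype.val h) x

/-! ### Smooth principal bundles -/

section Bundles

variable (E : Type v) [AddCommGroup E] [Module ℝ E] [TopologicalSpace E]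
  (G : Type w) [TopologicalSpace G] [ChartedSpace E G] [Group G]

/-- A smooth principal `G`-bundle over `B`, where `B` is regarded as a subspace of the
`n`-manifold `M` by means of `ι : B → M`: a space `Total` with a right action of `G` and a map to
`B`, with an atlas of equivariant local trivializations `P|_U ≃ U × G` whose transition maps,
which are left multiplications by functions `U ∩ U' → G`, are smooth. -/
structure SmoothBundle (n : ℕ) {M : Type u} [TopologicalSpace M]
    [ChartedSpace (EuclideanSpace ℝ (Fin n)) M] {B : Type u'} [TopologicalSpace B]
    (ι : B → M) where
  /-- The total space. -/
  Total : Type v'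
  [topology : TopologicalSpace Total]
  /-- The right action of `G`. -/
  [action : MulAction Gᵐᵒᵖ Total]
  /-- The bundle projection. -/
  proj : Total → B
  /-- The smooth `G`-bundle charts. -/
  atlas : Set (Bundle.Trivialization G proj)
  exists_chart : ∀ b, ∃ e ∈ atlas, b ∈ e.baseSet
  proj_smul : ∀ (g : G) (p : Total), proj (MulOpposite.op g • p) = proj p
  equivariant : ∀ e ∈ atlas, ∀ p, proj p ∈ e.baseSet → ∀ g : G,
    e (MulOpposite.op g • p) = ((e p).1, (e p).2 * g)
  smooth_transition : ∀ e ∈ atlas, ∀ e' ∈ atlas,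
    SmoothAlong E n ι (fun b => (e' (e.toOpenPartialHomeomorph.symm (b, 1))).2)
      (e.baseSet ∩ e'.baseSet)

attribute [instance] SmoothBundle.topology SmoothBundle.action

/-- Smooth principal `G`-bundles over the simplex `Δ^n`. -/
abbrev SimplexBundle (n : ℕ) := SmoothBundle.{0, v, w, 0, v'} E G n (simplexIncl n)

/-- Smooth principal `G`-bundles over the smooth manifold `Y`. -/
abbrev ManifoldBundle (d : ℕ) (Y : Type u) [TopologicalSpace Y]
    [ChartedSpace (EuclideanSpace ℝ (Fin d)) Y] :=
  SmoothBundle.{u, v, w, u, v'} E G d (id : Y → Y)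

variable {E G}

/-- A smooth `G`-bundle map `P → Q` over the (smooth) map `φ` of the bases: a `G`-equivariant map
which covers `φ` and which is smooth; in bundle charts it is of the form
`(b, g) ↦ (φ b, s b * g)`, and `s` has to be smooth. -/
@[ext]
structure BundleMap {n n' : ℕ} {M : Type*} [TopologicalSpace M]
    [ChartedSpace (EuclideanSpace ℝ (Fin n)) M] {M' : Type*} [TopologicalSpace M']
    [ChartedSpace (EuclideanSpace ℝ (Fin n')) M'] {B : Type*} [TopologicalSpace B]
    {B' : Type*} [TopologicalSpace B'] {ι : B → M} {ι' : B' → M'}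
    (P : SmoothBundle E G n ι) (Q : SmoothBundle E G n' ι') (φ : B → B') where
  /-- The map of total spaces. -/
  toFun : P.Total → Q.Total
  proj_toFun : ∀ p, Q.proj (toFun p) = φ (P.proj p)
  map_smul : ∀ (g : G) (p : P.Total), toFun (MulOpposite.op g • p) = MulOpposite.op g • toFun p
  smooth : ∀ e ∈ P.atlas, ∀ e' ∈ Q.atlas,
    SmoothAlong E n ι (fun b => (e' (toFun (e.toOpenPartialHomeomorph.symm (b, 1)))).2)
      (e.baseSet ∩ φ ⁻¹' e'.baseSet)

/-- A smooth simplicial `G`-bundle over the smooth simplicial set `X`: a functor from `Δ^sm(X)` to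
smooth `G`-bundles which sends a `d`-simplex to a bundle over `Δ^d` and a morphism `f` to a bundle
map over the underlying smooth map of simplices. -/
structure SimplicialBundle (E : Type v) [AddCommGroup E] [Module ℝ E] [TopologicalSpace E]
    (G : Type w) [TopologicalSpace G] [ChartedSpace E G] [Group G] (X : SmoothSSet.{u}) where
  /-- The bundle `P_Σ` over `Δ^d`, for a `d`-simplex `Σ`. -/
  obj : ∀ S : SmSimplexCat X, SimplexBundle.{v, w, v'} E G S.left.dim
  /-- The bundle map `P(f)` for a morphism `f`. -/
  map : ∀ {S T : SmSimplexCat X} (f : S ⟶ T), BundleMap (obj S) (obj T) (SmSimplex.mapOf f.left)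
  map_id : ∀ (S : SmSimplexCat X) (p : (obj S).Total), (map (𝟙 S)).toFun p = p
  map_comp : ∀ {S T R : SmSimplexCat X} (f : S ⟶ T) (g : T ⟶ R) (p : (obj S).Total),
    (map (f ≫ g)).toFun p = (map g).toFun ((map f).toFun p)

/-- A simplicial `G`-bundle map over the identity of `X`: a natural transformation whose components
are bundle maps over the identity. -/
structure SimplicialBundleMap {X : SmoothSSet.{u}} (P : SimplicialBundle.{u, v, w, u'} E G X)
    (Q : SimplicialBundle.{u, v, w, v'} E G X) where
  /-- The component at a simplex. -/
  app : ∀ S : SmSimplexCat X, BundleMap (P.obj S) (Q.obj S) id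
  naturality : ∀ {S T : SmSimplexCat X} (f : S ⟶ T) (p : (P.obj S).Total),
    (app T).toFun ((P.map f).toFun p) = (Q.map f).toFun ((app S).toFun p)

/-- There is a simplicial `G`-bundle isomorphism `P → Q`. -/
def SimplicialBundle.Isomorphic {X : SmoothSSet.{u}} (P : SimplicialBundle.{u, v, w, u'} E G X)
    (Q : SimplicialBundle.{u, v, w, v'} E G X) : Prop :=
  ∃ (h : SimplicialBundleMap P Q) (k : SimplicialBundleMap Q P),
    (∀ S p, (k.app S).toFun ((h.app S).toFun p) = p) ∧
    (∀ S p, (h.app S).toFun ((k.app S).toFun p) = p)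

end Bundles

/-! ### The simplicial bundle induced by a bundle over a manifold -/

section SmoothPullback

variable {E : Type v} [AddCommGroup E] [Module ℝ E] [TopologicalSpace E]
  [IsTopologicalAddGroup E] [ContinuousSMul ℝ E] [LocallyConvexSpace ℝ E] [T2Space E]
  {G : Type w} [TopologicalSpace G] [ChartedSpace E G]
  {d : ℕ} {Y : Type u} [TopologicalSpace Y] [ChartedSpace (EuclideanSpace ℝ (Fin d)) Y]
  [IsManifold (𝓡 d) ∞ Y]

theorem SmoothMapOn.comp {m : ℕ} {g : Y → G} {W : Set Y} (hW : IsOpen W)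
    (hg : SmoothMapOn E d g W) {h : EuclideanSpace ℝ (Fin m) → Y}
    {W' : Set (EuclideanSpace ℝ (Fin m))} (hW' : IsOpen W')
    (hh : ContMDiffOn (𝓡 m) (𝓡 d) ∞ h W') :
    SmoothMapOn E m (fun x => g (h x)) (W' ∩ h ⁻¹' W) := by
  have hopen : IsOpen (W' ∩ h ⁻¹' W) := hh.continuousOn.isOpen_inter_preimage hW' hW
  have hcont : ContinuousOn (fun x => g (h x)) (W' ∩ h ⁻¹' W) :=
    hg.1.comp (hh.continuousOn.mono inter_subset_left) fun x hx => hx.2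
  refine ⟨hcont, fun a ha c hc k => ?_⟩
  rw [chartedSpaceSelf_atlas] at ha
  subst ha
  have hS : {x | x ∈ (OpenPartialHomeomorph.refl (EuclideanSpace ℝ (Fin m))).target ∧
      (OpenPartialHomeomorph.refl (EuclideanSpace ℝ (Fin m))).symm x ∈ W' ∩ h ⁻¹' W ∧
      g (h ((OpenPartialHomeomorph.refl (EuclideanSpace ℝ (Fin m))).symm x)) ∈ c.source} =
      (W' ∩ h ⁻¹' W) ∩ (fun x => g (h x)) ⁻¹' c.source := by
    ext x; simp
  rw [hS]
  have hSo := hcont.isOpen_inter_preimage hopen c.open_source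
  refine IsCkOn.of_local hSo fun x hx => ?_
  set a := chartAt (EuclideanSpace ℝ (Fin d)) (h x) with ha
  refine ⟨W' ∩ h ⁻¹' a.source, hh.continuousOn.isOpen_inter_preimage hW' a.open_source,
    ⟨hx.1.1, mem_chart_source _ _⟩, ?_⟩
  have hVo : IsOpen (((W' ∩ h ⁻¹' W) ∩ (fun x => g (h x)) ⁻¹' c.source) ∩
      (W' ∩ h ⁻¹' a.source)) :=
    hSo.inter (hh.continuousOn.isOpen_inter_preimage hW' a.open_source)
  have hinner : ContDiffOn ℝ ∞ (fun x => a (h x)) (W' ∩ h ⁻¹' a.source) := by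
    rw [← contMDiffOn_iff_contDiffOn]
    exact (contMDiffOn_chart (I := 𝓡 d) (n := ∞) (x := h x)).comp (hh.mono inter_subset_left)
      fun y hy => hy.2
  have hc2 := hg.2 a (chart_mem_atlas _ _) c hc k
  have hT : IsOpen {z | z ∈ a.target ∧ a.symm z ∈ W ∧ g (a.symm z) ∈ c.source} := by
    have h1 := a.symm.continuousOn.isOpen_inter_preimage a.symm.open_source
      (hg.1.isOpen_inter_preimage hW c.open_source)
    exact h1
  refine IsCkOn.congr hVo (IsCkOn.comp hT hc2
    (IsCkOn.of_contDiffOn hVo (hinner.mono inter_subset_right)) ?_) ?_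
  · rintro y ⟨⟨⟨-, hy1⟩, hy2⟩, -, hy3⟩
    refine ⟨a.map_source hy3, ?_, ?_⟩
    · rw [a.left_inv hy3]; exact hy1
    · rw [a.left_inv hy3]; exact hy2
  · rintro y ⟨-, -, hy3⟩
    show c (g (a.symm (a (h y)))) = c (g (h y))
    rw [a.left_inv hy3]

/-- Smooth maps on subsets of `Y` can be pulled back along smooth simplices. -/
theorem SmoothAlong.comp_simplex {m : ℕ} {f : Y → G} {A : Set Y}
    (hf : SmoothAlong E d (id : Y → Y) f A) {σ : Simplex m → Y} (hσ : SmoothOnSimplex d σ) :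
    SmoothAlong E m (simplexIncl m) (fun x => f (σ x)) (σ ⁻¹' A) := by
  intro x hx
  obtain ⟨W, hW, hxW, g, hg, hfg⟩ := hf (σ x) hx
  obtain ⟨W', hW', hxW', h, hh, hσh⟩ := hσ x
  refine ⟨W' ∩ h ⁻¹' W, hh.continuousOn.isOpen_inter_preimage hW' hW, ⟨hxW', ?_⟩,
    fun y => g (h y), hg.comp hW hW' hh, ?_⟩
  · rw [mem_preimage, ← hσh x hxW']
    exact hxW
  · rintro y hy ⟨hy1, hy2⟩
    rw [mem_preimage, ← hσh y hy1] at hy2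
    exact (hfg _ hy hy2).trans (congrArg g (hσh y hy1))

end SmoothPullback

section Pullback

variable {E : Type v} [AddCommGroup E] [Module ℝ E] [TopologicalSpace E]
  {G : Type w} [TopologicalSpace G] [ChartedSpace E G] [Group G]
  {d : ℕ} {Y : Type u} [TopologicalSpace Y] [ChartedSpace (EuclideanSpace ℝ (Fin d)) Y]
  (N : ManifoldBundle.{u, v, w, v'} E G d Y)

/-- The total space `{(x, p) | σ x = proj p}` of the pull-back of `N` along `σ : Δ^m → Y`. -/
abbrev PullbackTotal {m : ℕ} (σ : Simplex m → Y) : Type v' :=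
  {z : Simplex m × N.Total // σ z.1 = N.proj z.2}

instance {m : ℕ} (σ : Simplex m → Y) : MulAction Gᵐᵒᵖ (PullbackTotal N σ) where
  smul g z := ⟨(z.1.1, g • z.1.2), z.2.trans (N.proj_smul g.unop z.1.2).symm⟩
  one_smul z := Subtype.ext (Prod.ext rfl (one_smul _ z.1.2))
  mul_smul g h z := Subtype.ext (Prod.ext rfl (mul_smul g h z.1.2))

theorem exists_pullback_point {m : ℕ} (σ : Simplex m → Y)
    (e : Bundle.Trivialization G N.proj) (z : Simplex m × G) :
    ∃ q : PullbackTotal N σ, q.1.1 = z.1 ∧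
      (σ z.1 ∈ e.baseSet → q.1.2 = e.toOpenPartialHomeomorph.symm (σ z.1, z.2)) := by
  by_cases hz : σ z.1 ∈ e.baseSet
  · exact ⟨⟨(z.1, e.toOpenPartialHomeomorph.symm (σ z.1, z.2)),
      (e.proj_symm_apply' hz).symm⟩, rfl, fun _ => rfl⟩
  · obtain ⟨e', -, he'⟩ := N.exists_chart (σ z.1)
    exact ⟨⟨(z.1, e'.toOpenPartialHomeomorph.symm (σ z.1, z.2)),
      (e'.proj_symm_apply' he').symm⟩, rfl, fun h => absurd h hz⟩

/-- The pull-back of a local trivialization: `(x, p) ↦ (x, g)`, where `e p = (σ x, g)`. -/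
noncomputable def pullbackTriv {m : ℕ} {σ : Simplex m → Y} (hσ : Continuous σ)
    (e : Bundle.Trivialization G N.proj) :
    Bundle.Trivialization G (fun z : PullbackTotal N σ => z.1.1) where
  toFun z := (z.1.1, (e z.1.2).2)
  invFun z := (exists_pullback_point N σ e z).choose
  source := {z | σ z.1.1 ∈ e.baseSet}
  target := (σ ⁻¹' e.baseSet) ×ˢ univ
  map_source' z hz := ⟨hz, trivial⟩
  map_target' z hz := by
    have h := (exists_pullback_point N σ e z).choose_spec.1
    show σ _ ∈ e.baseSet
    rw [h]
    exact hz.1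
  left_inv' z hz := by
    have h := (exists_pullback_point N σ e (z.1.1, (e z.1.2).2)).choose_spec
    refine Subtype.ext (Prod.ext h.1 ((h.2 hz).trans ?_))
    have hp : N.proj z.1.2 ∈ e.baseSet := z.2 ▸ hz
    show e.toOpenPartialHomeomorph.symm (σ z.1.1, (e z.1.2).2) = z.1.2
    rw [z.2]
    exact e.symm_apply_mk_proj (e.mem_source.2 hp)
  right_inv' z hz := by
    have h := (exists_pullback_point N σ e z).choose_spec
    refine Prod.ext h.1 ?_
    show (e _).2 = z.2
    rw [h.2 hz.1, e.apply_symm_apply' hz.1]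
  open_source := e.open_baseSet.preimage (hσ.comp (continuous_fst.comp continuous_subtype_val))
  open_target := (e.open_baseSet.preimage hσ).prod isOpen_univ
  continuousOn_toFun := by
    refine ContinuousOn.prodMk (continuous_fst.comp continuous_subtype_val).continuousOn ?_
    refine continuous_snd.comp_continuousOn (e.continuousOn_toFun.comp
      (continuous_snd.comp continuous_subtype_val).continuousOn ?_)
    intro z hz
    have hz' : σ z.1.1 ∈ e.baseSet := hz
    exact e.mem_source.2 (z.2 ▸ hz')
  continuousOn_invFun := by
    refine Topology.IsInducing.subtypeVal.continuousOn_iff.2 ?_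
    have hc : ContinuousOn (fun z : Simplex m × G =>
        (z.1, e.toOpenPartialHomeomorph.symm (σ z.1, z.2))) ((σ ⁻¹' e.baseSet) ×ˢ univ) := by
      refine continuous_fst.continuousOn.prodMk
        (e.toOpenPartialHomeomorph.continuousOn_symm.comp (by fun_prop) ?_)
      intro z hz
      exact e.mem_target.2 hz.1
    refine hc.congr fun z hz => ?_
    have h := (exists_pullback_point N σ e z).choose_spec
    exact Prod.ext h.1 (h.2 hz.1)
  baseSet := σ ⁻¹' e.baseSet
  open_baseSet := e.open_baseSet.preimage hσ
  source_eq := rfl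
  target_eq := rfl
  proj_toFun _ _ := rfl

theorem pullbackTriv_symm_apply {m : ℕ} {σ : Simplex m → Y} (hσ : Continuous σ)
    (e : Bundle.Trivialization G N.proj) {x : Simplex m} (hx : σ x ∈ e.baseSet) (g : G) :
    ((pullbackTriv N hσ e).toOpenPartialHomeomorph.symm (x, g)).1 =
      (x, e.toOpenPartialHomeomorph.symm (σ x, g)) :=
  have h := (exists_pullback_point N σ e (x, g)).choose_spec
  Prod.ext h.1 (h.2 hx)

variable [IsTopologicalAddGroup E] [ContinuousSMul ℝ E] [LocallyConvexSpace ℝ E] [T2Space E]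
  [IsManifold (𝓡 d) ∞ Y]

/-- The pull-back `σ^* N` of a smooth `G`-bundle `N → Y` along a smooth map `σ : Δ^m → Y`. -/
noncomputable def pullbackBundle {m : ℕ} (σ : Simplex m → Y) (hσ : SmoothOnSimplex d σ) :
    SimplexBundle.{v, w, v'} E G m where
  Total := PullbackTotal N σ
  proj z := z.1.1
  atlas := {e' | ∃ e ∈ N.atlas, e' = pullbackTriv N hσ.continuous e}
  exists_chart x := by
    obtain ⟨e, he, hx⟩ := N.exists_chart (σ x)
    exact ⟨_, ⟨e, he, rfl⟩, hx⟩
  proj_smul _ _ := rfl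
  equivariant := by
    rintro _ ⟨e, he, rfl⟩ z hz g
    have hz' : σ z.1.1 ∈ e.baseSet := hz
    have h := congrArg Prod.snd (N.equivariant e he z.1.2 (z.2 ▸ hz') g)
    exact Prod.ext rfl h
  smooth_transition := by
    rintro _ ⟨e, he, rfl⟩ _ ⟨e', he', rfl⟩ x hx
    obtain ⟨W, hW, hxW, g, hg, hfg⟩ := (N.smooth_transition e he e' he').comp_simplex hσ x hx
    refine ⟨W, hW, hxW, g, hg, fun y hy hyW => ?_⟩
    rw [← hfg y hy hyW]
    show (e' _).2 = (e' _).2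
    rw [pullbackTriv_symm_apply N hσ.continuous e hy.1]

/-- The simplicial `G`-bundle `N_•` over `Y_•` induced by `N → Y`: it assigns `Σ^* N` to `Σ`, and
the natural map `Σ₁^* N = f^* Σ₂^* N → Σ₂^* N` to a morphism `f : Σ₁ → Σ₂`. -/
noncomputable def inducedBundle : SimplicialBundle.{u, v, w, v'} E G (singSm d Y) where
  obj S := pullbackBundle N (simplexMap S).1 (simplexMap S).2
  map {S T} f :=
    { toFun := fun z => ⟨(SmSimplex.mapOf f.left z.1.1, z.1.2), (simplexMap_comp f _).trans z.2⟩
      proj_toFun := fun _ => rfl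
      map_smul := fun _ _ => rfl
      smooth := by
        rintro _ ⟨e, he, rfl⟩ _ ⟨e', he', rfl⟩ x hx
        have hsub : ∀ y, y ∈ (pullbackTriv N (simplexMap S).2.continuous e).baseSet ∩
            SmSimplex.mapOf f.left ⁻¹'
              (pullbackTriv N (simplexMap T).2.continuous e').baseSet →
            y ∈ (simplexMap S).1 ⁻¹' (e.baseSet ∩ e'.baseSet) := by
          rintro y ⟨hy, hy'⟩
          refine ⟨hy, ?_⟩
          have h2 : (simplexMap T).1 (SmSimplex.mapOf f.left y) ∈ e'.baseSet := hy'
          rwa [simplexMap_comp] at h2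
        obtain ⟨W, hW, hxW, g, hg, hfg⟩ :=
          (N.smooth_transition e he e' he').comp_simplex (simplexMap S).2 x (hsub x hx)
        refine ⟨W, hW, hxW, g, hg, fun y hy hyW => ?_⟩
        rw [← hfg y (hsub y hy) hyW]
        have h := pullbackTriv_symm_apply N (simplexMap S).2.continuous e hy.1 1
        exact congrArg (fun z : Simplex S.left.dim × N.Total => (e' z.2).2) h }
  map_id _ _ := rfl
  map_comp _ _ _ := rfl

/-- The simplicial `G`-bundle `P` over `Y_•` is inducible by the smooth `G`-bundle `N → Y`: there
is a simplicial `G`-bundle isomorphism `N_• → P`. -/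
def SimplicialBundle.InducibleBy (P : SimplicialBundle.{u, v, w, u'} E G (singSm d Y))
    (N : ManifoldBundle.{u, v, w, v'} E G d Y) : Prop :=
  (inducedBundle N).Isomorphic P

end Pullback

/-!
The fibre of `N` over `y` is forced: it is the total space of the bundle which `P` assigns to the
`0`-simplex `y`. If `x` is a point of a simplex `S : Δ^m → Y` over `y`, then `x` is a morphism from
the `0`-simplex `y` to `S`, and the functoriality of `P` yields an equivariant bijection from the
fibre over `y` onto the fibre of `P_S` over `x` (`SimplicialBundle.transport`), compatible with all
morphisms of simplices (`map_transport`). So, as a family of `G`-sets, `P_S` is the pull-back of the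
family of fibres along `S`, and only the smooth structure has to be found.

Near each point of `Y` there is a simplex `Δ^d → Y` with a smooth right inverse on an open set
(`SimplexChart.exists_mem_domain`), and a local trivialization of the bundle over it (a
`SimplicialBundle.Frame`) gives coordinates in `G` on the nearby fibres. The main point is
`exists_smooth_comparison`: for every simplex `S`, a bundle chart of `P_S` and the coordinates of a
frame differ by a smooth function on the simplex. To see this near a point `x`, the simplex `S` is
composed with a contraction `f` of `Δ^m` with centre `x`, so small that the image in `Y` lies in the
domain of the frame. Then `S ∘ f` also factors smoothly through the simplex of the frame; `P` turns
both maps of simplices into smooth bundle maps out of `P_{S ∘ f}`, and the comparison function,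
composed with `f`, is a quotient of the two functions that describe these bundle maps. Since the
image of `f` is a neighbourhood of `x` in `Δ^m`, also when `x` lies on the boundary
(`Simplex.exists_dilation_mem`), and `f` is the restriction of an affine automorphism, the
comparison function itself is smooth near `x`.

For the simplices of frames this shows that the transition functions between frames are smooth, so
that the fibres form a smooth principal bundle (`gluedBundle`); for an arbitrary simplex it shows
that transport is a smooth isomorphism from the pull-back of this bundle to `P_S` (`gluedHom`,
`gluedInv`).
-/

/-! ### Smooth maps into a Lie group -/

section SmoothGroupMaps

/-- The domain of a chart representation is open. -/
theorem isOpen_chart_domain {G : Type*} [TopologicalSpace G] {M : Type*} [TopologicalSpace M]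
    {X : Type*} [TopologicalSpace X] (a : OpenPartialHomeomorph M X) {g : M → G} {W : Set M} (hW : IsOpen W)
    (hg : ContinuousOn g W) {s : Set G} (hs : IsOpen s) :
    IsOpen {x | x ∈ a.target ∧ a.symm x ∈ W ∧ g (a.symm x) ∈ s} :=
  a.symm.continuousOn.isOpen_inter_preimage a.symm.open_source (hg.isOpen_inter_preimage hW hs)

variable {E : Type v} [AddCommGroup E] [Module ℝ E] [TopologicalSpace E]
  {G : Type w} [TopologicalSpace G] [ChartedSpace E G]

theorem SmoothMapOn.mono {n : ℕ} {M : Type*} [TopologicalSpace M]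
    [ChartedSpace (EuclideanSpace ℝ (Fin n)) M] {g : M → G} {W W' : Set M}
    (hg : SmoothMapOn E n g W) (h : W' ⊆ W) : SmoothMapOn E n g W' :=
  ⟨hg.1.mono h, fun a ha c hc k => (hg.2 a ha c hc k).mono fun _ hx => ⟨hx.1, h hx.2.1, hx.2.2⟩⟩

variable [IsTopologicalAddGroup E] [ContinuousSMul ℝ E] [LocallyConvexSpace ℝ E] [T2Space E]

/-- Smooth maps can be composed with smooth maps between finite-dimensional manifolds. -/
theorem SmoothMapOn.comp_contMDiffOn {m n : ℕ} {M : Type*} [TopologicalSpace M]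
    [ChartedSpace (EuclideanSpace ℝ (Fin n)) M] [IsManifold (𝓡 n) ∞ M] {M' : Type*}
    [TopologicalSpace M'] [ChartedSpace (EuclideanSpace ℝ (Fin m)) M'] [IsManifold (𝓡 m) ∞ M']
    {g : M → G} {W : Set M} (hW : IsOpen W) (hg : SmoothMapOn E n g W) {h : M' → M} {W' : Set M'}
    (hW' : IsOpen W') (hh : ContMDiffOn (𝓡 m) (𝓡 n) ∞ h W') :
    SmoothMapOn E m (fun x => g (h x)) (W' ∩ h ⁻¹' W) := by
  refine ⟨hg.1.comp (hh.continuousOn.mono inter_subset_left) fun x hx => hx.2,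
    fun a ha c hc => ?_⟩
  have hV : IsOpen (a.target ∩ a.symm ⁻¹' W') :=
    a.symm.continuousOn.isOpen_inter_preimage a.symm.open_source hW'
  have ha' : ContMDiffOn (𝓡 m) (𝓡 m) ∞ a.symm a.target :=
    contMDiffOn_symm_of_mem_maximalAtlas (IsManifold.subset_maximalAtlas ha)
  have hs : ContMDiffOn (𝓡 m) (𝓡 n) ∞ (fun x => h (a.symm x)) (a.target ∩ a.symm ⁻¹' W') :=
    hh.comp (ha'.mono inter_subset_left) fun x hx => hx.2
  have key := (hg.comp hW hV hs).2 (OpenPartialHomeomorph.refl _)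
    (by rw [chartedSpaceSelf_atlas]) c hc
  intro k
  refine (key k).mono ?_
  rintro x ⟨h1, ⟨h2, h3⟩, h4⟩
  exact ⟨trivial, ⟨⟨h1, h2⟩, h3⟩, h4⟩

variable [Group G] [FrechetLieGroup E G]

theorem SmoothMapOn.mul {n : ℕ} {M : Type*} [TopologicalSpace M]
    [ChartedSpace (EuclideanSpace ℝ (Fin n)) M] {g h : M → G} {W : Set M} (hW : IsOpen W)
    (hg : SmoothMapOn E n g W) (hh : SmoothMapOn E n h W) :
    SmoothMapOn E n (fun x => g x * h x) W := by
  have : IsTopologicalGroup G := FrechetLieGroup.toIsTopologicalGroup (E := E)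
  have hgh : ContinuousOn (fun x => g x * h x) W := hg.1.mul hh.1
  refine ⟨hgh, fun a ha c hc k => ?_⟩
  have hS := isOpen_chart_domain a hW hgh c.open_source
  refine IsCkOn.of_local hS fun x hx => ?_
  set a₁ := chartAt E (g (a.symm x))
  set a₂ := chartAt E (h (a.symm x))
  have hV := (isOpen_chart_domain a hW hg.1 a₁.open_source).inter
    (isOpen_chart_domain a hW hh.1 a₂.open_source)
  refine ⟨_, hV, ⟨⟨hx.1, hx.2.1, mem_chart_source _ _⟩, hx.1, hx.2.1, mem_chart_source _ _⟩, ?_⟩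
  have hT : IsOpen {z : E × E | z.1 ∈ a₁.target ∧ z.2 ∈ a₂.target ∧
      a₁.symm z.1 * a₂.symm z.2 ∈ c.source} := by
    have hc : ContinuousOn (fun z : E × E => a₁.symm z.1 * a₂.symm z.2)
        (a₁.target ×ˢ a₂.target) :=
      (a₁.symm.continuousOn.comp continuousOn_fst fun z hz => hz.1).mul
        (a₂.symm.continuousOn.comp continuousOn_snd fun z hz => hz.2)
    have := hc.isOpen_inter_preimage (a₁.open_target.prod a₂.open_target) c.open_source
    convert this using 1
    ext z
    exact and_assoc.symm
  have hmul := FrechetLieGroup.smooth_mul a₁ (chart_mem_atlas _ _) a₂ (chart_mem_atlas E _) c hc k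
  have hpair := ((hg.2 a ha a₁ (chart_mem_atlas _ _) k).mono inter_subset_left).prodMk
    ((hh.2 a ha a₂ (chart_mem_atlas _ _) k).mono inter_subset_right)
  refine (IsCkOn.comp hT hmul (hpair.mono inter_subset_right) ?_).congr (hS.inter hV) ?_
  · rintro y ⟨hy, hy₁, hy₂⟩
    refine ⟨a₁.map_source hy₁.2.2, a₂.map_source hy₂.2.2, ?_⟩
    simpa only [a₁.left_inv hy₁.2.2, a₂.left_inv hy₂.2.2] using hy.2.2
  · rintro y ⟨hy, hy₁, hy₂⟩
    simp only [a₁.left_inv hy₁.2.2, a₂.left_inv hy₂.2.2]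

theorem SmoothMapOn.inv {n : ℕ} {M : Type*} [TopologicalSpace M]
    [ChartedSpace (EuclideanSpace ℝ (Fin n)) M] {g : M → G} {W : Set M} (hW : IsOpen W)
    (hg : SmoothMapOn E n g W) : SmoothMapOn E n (fun x => (g x)⁻¹) W := by
  have : IsTopologicalGroup G := FrechetLieGroup.toIsTopologicalGroup (E := E)
  have hgi : ContinuousOn (fun x => (g x)⁻¹) W := hg.1.inv
  refine ⟨hgi, fun a ha c hc k => ?_⟩
  have hS := isOpen_chart_domain a hW hgi c.open_source
  refine IsCkOn.of_local hS fun x hx => ?_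
  set a₁ := chartAt E (g (a.symm x))
  have hV := isOpen_chart_domain a hW hg.1 a₁.open_source
  refine ⟨_, hV, ⟨hx.1, hx.2.1, mem_chart_source _ _⟩, ?_⟩
  have hT : IsOpen {z : E | z ∈ a₁.target ∧ (a₁.symm z)⁻¹ ∈ c.source} :=
    a₁.symm.continuousOn.inv.isOpen_inter_preimage a₁.open_target c.open_source
  have hinv := FrechetLieGroup.smooth_inv a₁ (chart_mem_atlas _ _) c hc k
  refine (IsCkOn.comp hT hinv ((hg.2 a ha a₁ (chart_mem_atlas _ _) k).mono
    inter_subset_right) ?_).congr (hS.inter hV) ?_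
  · rintro y ⟨hy, hy₁⟩
    refine ⟨a₁.map_source hy₁.2.2, ?_⟩
    simpa only [a₁.left_inv hy₁.2.2] using hy.2.2
  · rintro y ⟨hy, hy₁⟩
    simp only [a₁.left_inv hy₁.2.2]

end SmoothGroupMaps

/-! ### Smooth maps on subspaces of manifolds -/

section SmoothAlong

variable {E : Type v} [AddCommGroup E] [Module ℝ E] [TopologicalSpace E]
  {G : Type w} [TopologicalSpace G] [ChartedSpace E G]
  {m n : ℕ} {M : Type*} [TopologicalSpace M] [ChartedSpace (EuclideanSpace ℝ (Fin n)) M]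
  {M' : Type*} [TopologicalSpace M'] [ChartedSpace (EuclideanSpace ℝ (Fin m)) M']
  {B : Type*} {B' : Type*} {ι : B → M} {ι' : B' → M'}

theorem SmoothAlong.congr {f f' : B → G} {A : Set B} (hf : SmoothAlong E n ι f A)
    (h : EqOn f' f A) : SmoothAlong E n ι f' A := by
  intro b hb
  obtain ⟨W, hW, hbW, g, hg, hfg⟩ := hf b hb
  exact ⟨W, hW, hbW, g, hg, fun a ha haW => (h ha).trans (hfg a ha haW)⟩

theorem SmoothAlong.mono {f : B → G} {A A' : Set B} (hf : SmoothAlong E n ι f A)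
    (h : A' ⊆ A) : SmoothAlong E n ι f A' := by
  intro b hb
  obtain ⟨W, hW, hbW, g, hg, hfg⟩ := hf b (h hb)
  exact ⟨W, hW, hbW, g, hg, fun a ha haW => hfg a (h ha) haW⟩

theorem SmoothAlong.continuousOn [TopologicalSpace B] (hι : Continuous ι) {f : B → G} {A : Set B}
    (hf : SmoothAlong E n ι f A) : ContinuousOn f A := by
  intro b hb
  obtain ⟨W, hW, hbW, g, hg, hfg⟩ := hf b hb
  have h1 : ContinuousWithinAt (fun x => g (ι x)) A b :=
    ((hg.1.continuousAt (hW.mem_nhds hbW)).comp hι.continuousAt).continuousWithinAt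
  refine h1.congr_of_eventuallyEq ?_ (hfg b hb hbW)
  filter_upwards [self_mem_nhdsWithin, mem_nhdsWithin_of_mem_nhds
    (hι.continuousAt.preimage_mem_nhds (hW.mem_nhds hbW))] with a ha haW
  exact hfg a ha haW

variable [IsTopologicalAddGroup E] [ContinuousSMul ℝ E] [LocallyConvexSpace ℝ E] [T2Space E]

/-- A map which is locally of the form `f ∘ φ`, where `f` is smooth along `ι` and `φ` is induced by
a smooth map `h` of the ambient manifolds, is smooth. -/
theorem SmoothAlong.comp_of_local [IsManifold (𝓡 n) ∞ M] [IsManifold (𝓡 m) ∞ M']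
    {f' : B' → G} {A' : Set B'}
    (H : ∀ b ∈ A', ∃ (f : B → G) (A : Set B) (W' : Set M') (h : M' → M) (φ : B' → B),
      SmoothAlong E n ι f A ∧ IsOpen W' ∧ ι' b ∈ W' ∧ ContMDiffOn (𝓡 m) (𝓡 n) ∞ h W' ∧
      ∀ a ∈ A', ι' a ∈ W' → φ a ∈ A ∧ ι (φ a) = h (ι' a) ∧ f' a = f (φ a)) :
    SmoothAlong E m ι' f' A' := by
  intro b hb
  obtain ⟨f, A, W', h, φ, hf, hW', hbW', hh, hφ⟩ := H b hb
  obtain ⟨hA, hι, -⟩ := hφ b hb hbW'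
  obtain ⟨W, hW, hbW, g, hg, hfg⟩ := hf _ hA
  refine ⟨W' ∩ h ⁻¹' W, hh.continuousOn.isOpen_inter_preimage hW' hW, ⟨hbW', ?_⟩,
    fun x => g (h x), hg.comp_contMDiffOn hW hW' hh, ?_⟩
  · rwa [mem_preimage, ← hι]
  · rintro a ha ⟨haW', haW⟩
    obtain ⟨hA', hι', he⟩ := hφ a ha haW'
    rw [mem_preimage, ← hι'] at haW
    rw [he, hfg _ hA' haW, hι']

variable [Group G] [FrechetLieGroup E G]

theorem SmoothAlong.mul {f f' : B → G} {A : Set B} (hf : SmoothAlong E n ι f A)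
    (hf' : SmoothAlong E n ι f' A) : SmoothAlong E n ι (fun b => f b * f' b) A := by
  intro b hb
  obtain ⟨W, hW, hbW, g, hg, hfg⟩ := hf b hb
  obtain ⟨W', hW', hbW', g', hg', hfg'⟩ := hf' b hb
  exact ⟨W ∩ W', hW.inter hW', ⟨hbW, hbW'⟩, fun x => g x * g' x,
    (hg.mono inter_subset_left).mul (hW.inter hW') (hg'.mono inter_subset_right),
    fun a ha haW => congrArg₂ _ (hfg a ha haW.1) (hfg' a ha haW.2)⟩

theorem SmoothAlong.inv {f : B → G} {A : Set B} (hf : SmoothAlong E n ι f A) :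
    SmoothAlong E n ι (fun b => (f b)⁻¹) A := by
  intro b hb
  obtain ⟨W, hW, hbW, g, hg, hfg⟩ := hf b hb
  exact ⟨W, hW, hbW, fun x => (g x)⁻¹, hg.inv hW, fun a ha haW => congrArg _ (hfg a ha haW)⟩

end SmoothAlong

/-! ### Fibres of principal bundles -/

namespace SmoothBundle

variable {E : Type v} [AddCommGroup E] [Module ℝ E] [TopologicalSpace E]
  {G : Type w} [TopologicalSpace G] [ChartedSpace E G] [Group G]
  {n : ℕ} {M : Type*} [TopologicalSpace M] [ChartedSpace (EuclideanSpace ℝ (Fin n)) M]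
  {B : Type*} [TopologicalSpace B] {ι : B → M} (P : SmoothBundle E G n ι)

variable {P} in
theorem coord_smul {e : Bundle.Trivialization G P.proj} (he : e ∈ P.atlas) {p : P.Total}
    (hp : P.proj p ∈ e.baseSet) (g : G) : (e (MulOpposite.op g • p)).2 = (e p).2 * g := by
  rw [P.equivariant e he p hp g]

variable {P} in
theorem eq_of_coord_eq {e : Bundle.Trivialization G P.proj} {p q : P.Total}
    (hp : P.proj p ∈ e.baseSet) (hpq : P.proj p = P.proj q) (h : (e p).2 = (e q).2) : p = q := by
  have hp' := e.mem_source.2 hp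
  have hq' := e.mem_source.2 (hpq ▸ hp)
  refine e.injOn hp' hq' (Prod.ext ?_ h)
  exact (e.coe_fst hp').trans (hpq.trans (e.coe_fst hq').symm)

theorem exists_smul_eq {p q : P.Total} (h : P.proj p = P.proj q) :
    ∃ g : G, MulOpposite.op g • p = q := by
  obtain ⟨e, he, hp⟩ := P.exists_chart (P.proj p)
  refine ⟨(e p).2⁻¹ * (e q).2, eq_of_coord_eq (e := e) ?_ ?_ ?_⟩
  · rwa [P.proj_smul]
  · rwa [P.proj_smul]
  · rw [coord_smul he hp, mul_inv_cancel_left]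

theorem smul_left_injective {p : P.Total} {g h : G}
    (hgh : MulOpposite.op g • p = MulOpposite.op h • p) : g = h := by
  obtain ⟨e, he, hp⟩ := P.exists_chart (P.proj p)
  have := congrArg (fun q => (e q).2) hgh
  simpa only [coord_smul he hp, mul_right_inj] using this

theorem exists_proj_eq (b : B) : ∃ p : P.Total, P.proj p = b := by
  obtain ⟨e, -, hb⟩ := P.exists_chart b
  exact ⟨e.toOpenPartialHomeomorph.symm (b, 1), e.proj_symm_apply' hb⟩

end SmoothBundle

/-! ### Contractions of simplices -/

namespace Simplex

variable {m : ℕ}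

theorem norm_le_one (x : Simplex m) : ‖(x : EuclideanSpace ℝ (Fin m))‖ ≤ 1 := by
  have h : ‖(x : EuclideanSpace ℝ (Fin m))‖ ^ 2 ≤ 1 := by
    rw [EuclideanSpace.real_norm_sq_eq]
    refine le_trans (Finset.sum_le_sum fun i _ => ?_) x.2.2
    have h0 := x.2.1 i
    have h1 : (x : EuclideanSpace ℝ (Fin m)) i ≤ 1 :=
      (Finset.single_le_sum (fun j _ => x.2.1 j) (Finset.mem_univ i)).trans x.2.2
    nlinarith
  nlinarith [norm_nonneg (x : EuclideanSpace ℝ (Fin m))]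

theorem norm_sub_le_two (x y : Simplex m) :
    ‖(x : EuclideanSpace ℝ (Fin m)) - (y : EuclideanSpace ℝ (Fin m))‖ ≤ 2 :=
  (norm_sub_le _ _).trans (by linarith [norm_le_one x, norm_le_one y])

/-- The contraction `z ↦ x + ε (z - x)` of `Δ^m` with centre `x`. -/
def contraction (x : Simplex m) (ε : ℝ) (h0 : 0 ≤ ε) (h1 : ε ≤ 1) : SmSimplexHom m m where
  toFun z := ⟨(x : EuclideanSpace ℝ (Fin m)) + ε • ((z : EuclideanSpace ℝ (Fin m)) - x), by
    have hz := z.2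
    have hx := x.2
    refine ⟨fun i => ?_, ?_⟩
    · have := hz.1 i
      have := hx.1 i
      simp only [PiLp.add_apply, PiLp.smul_apply, PiLp.sub_apply, smul_eq_mul]
      nlinarith
    · have := hz.2
      have := hx.2
      simp only [PiLp.add_apply, PiLp.smul_apply, PiLp.sub_apply, smul_eq_mul,
        Finset.sum_add_distrib, ← Finset.mul_sum, Finset.sum_sub_distrib]
      nlinarith⟩
  smooth _ := ⟨univ, isOpen_univ, trivial,
    fun z => (x : EuclideanSpace ℝ (Fin m)) + ε • (z - x),
    ContDiff.contMDiff (by fun_prop) |>.contMDiffOn, fun _ _ => rfl⟩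

/-- The image of a contraction of `Δ^m` is a neighbourhood of its centre in `Δ^m`, even if the
centre is a boundary point: the inequalities which hold with equality at the centre are preserved
by dilations. -/
theorem exists_dilation_mem (x : Simplex m) {ε : ℝ} (h0 : 0 < ε) :
    ∃ W : Set (EuclideanSpace ℝ (Fin m)), IsOpen W ∧ (x : EuclideanSpace ℝ (Fin m)) ∈ W ∧
      ∀ y : Simplex m, (y : EuclideanSpace ℝ (Fin m)) ∈ W →
        (x : EuclideanSpace ℝ (Fin m)) + ε⁻¹ • ((y : EuclideanSpace ℝ (Fin m)) - x) ∈
          Simplex m := by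
  set D : EuclideanSpace ℝ (Fin m) → EuclideanSpace ℝ (Fin m) :=
    fun y => (x : EuclideanSpace ℝ (Fin m)) + ε⁻¹ • (y - x) with hD
  have hDx : D x = x := by simp [hD]
  have hDi : ∀ i, Continuous fun y => D y i := fun i => by fun_prop
  have hi : ∀ i, ∀ᶠ y in 𝓝 (x : EuclideanSpace ℝ (Fin m)),
      0 < (x : EuclideanSpace ℝ (Fin m)) i → 0 < D y i := by
    intro i
    by_cases hxi : 0 < (x : EuclideanSpace ℝ (Fin m)) i
    · have := ((hDi i).tendsto (x : EuclideanSpace ℝ (Fin m))).eventually_const_lt (u := 0)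
        (by rwa [hDx])
      exact this.mono fun y hy _ => hy
    · exact Eventually.of_forall fun y h => absurd h hxi
  have hs : ∀ᶠ y in 𝓝 (x : EuclideanSpace ℝ (Fin m)),
      ∑ i, (x : EuclideanSpace ℝ (Fin m)) i < 1 → ∑ i, D y i < 1 := by
    by_cases hxs : ∑ i, (x : EuclideanSpace ℝ (Fin m)) i < 1
    · have hc : Continuous fun y => ∑ i, D y i := continuous_finsetSum _ fun i _ => hDi i
      have := (hc.tendsto (x : EuclideanSpace ℝ (Fin m))).eventually_lt_const (u := 1)
        (by rwa [hDx])
      exact this.mono fun y hy _ => hy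
    · exact Eventually.of_forall fun y h => absurd h hxs
  obtain ⟨W, hW, hWo, hxW⟩ := eventually_nhds_iff.1 ((eventually_all.2 hi).and hs)
  refine ⟨W, hWo, hxW, fun y hy => ⟨fun i => ?_, ?_⟩⟩
  -- an inequality which is strict at `x` stays strict near `x`; one which is an equality is
  -- homogeneous with respect to dilations with centre `x`
  · rcases (x.2.1 i).eq_or_lt with h | h
    · have hy0 := y.2.1 i
      have : 0 ≤ ε⁻¹ * (y : EuclideanSpace ℝ (Fin m)) i := by positivity
      simpa [← h] using this
    · exact ((hW y hy).1 i h).le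
  · rcases x.2.2.eq_or_lt with h | h
    · have hy1 := y.2.2
      have : ε⁻¹ * (∑ i, (y : EuclideanSpace ℝ (Fin m)) i - 1) ≤ 0 :=
        mul_nonpos_of_nonneg_of_nonpos (by positivity) (by linarith)
      simp only [PiLp.add_apply, PiLp.smul_apply, PiLp.sub_apply, smul_eq_mul,
        Finset.sum_add_distrib, ← Finset.mul_sum, Finset.sum_sub_distrib, h]
      linarith
    · exact ((hW y hy).2 h).le

/-- The simplex `Δ^m` has an interior point, namely `(1 / (m + 1), …, 1 / (m + 1))`. -/
theorem interior_nonempty : (interior (Simplex m)).Nonempty := by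
  refine ⟨WithLp.toLp 2 fun _ => 1 / ((m : ℝ) + 1), mem_interior_iff_mem_nhds.2 ?_⟩
  have hi : ∀ i : Fin m, ∀ᶠ y in 𝓝 (WithLp.toLp 2 fun _ => 1 / ((m : ℝ) + 1)),
      0 < (y : EuclideanSpace ℝ (Fin m)) i := fun i => by
    have hc : Continuous fun y : EuclideanSpace ℝ (Fin m) => y i := by fun_prop
    exact hc.continuousAt.eventually_const_lt (by simp only; positivity)
  have hs : ∀ᶠ y in 𝓝 (WithLp.toLp 2 fun _ => 1 / ((m : ℝ) + 1)),
      ∑ i, (y : EuclideanSpace ℝ (Fin m)) i < 1 := by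
    have hc : Continuous fun y : EuclideanSpace ℝ (Fin m) => ∑ i, y i := by fun_prop
    refine hc.continuousAt.eventually_lt_const ?_
    simp only [Finset.sum_const, Finset.card_univ, Fintype.card_fin, nsmul_eq_mul]
    rw [mul_one_div, div_lt_one (by positivity)]
    linarith
  filter_upwards [eventually_all.2 hi, hs] with y h1 h2
  exact ⟨fun i => (h1 i).le, h2.le⟩

end Simplex

/-! ### Objects and morphisms of the category of smooth simplices of a manifold -/

section SimplexCategory

variable {d : ℕ} {Y : Type u} [TopologicalSpace Y] [ChartedSpace (EuclideanSpace ℝ (Fin d)) Y]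

/-- The object of `Δ^sm(Y_•)` given by a smooth map `σ : Δ^m → Y`. -/
noncomputable abbrev simplexObj {m : ℕ} (σ : Simplex m → Y) (hσ : SmoothOnSimplex d σ) :
    SmSimplexCat (singSm d Y) :=
  CostructuredArrow.mk (S := (uliftYoneda.{u} : SmSimplex ⥤ SmSimplexᵒᵖ ⥤ Type u))
    (Y := SmSimplex.mk m) ((uliftYonedaEquiv.{u} (F := singSm d Y)).symm ⟨σ, hσ⟩)

theorem simplexMap_simplexObj {m : ℕ} (σ : Simplex m → Y) (hσ : SmoothOnSimplex d σ) :
    (simplexMap (simplexObj σ hσ)).1 = σ :=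
  congrArg Subtype.val ((uliftYonedaEquiv.{u} (F := singSm d Y)).apply_symm_apply ⟨σ, hσ⟩)

/-- The morphism `S ⟶ T` of `Δ^sm(Y_•)` given by a smooth map of simplices which is compatible with
the maps to `Y`. -/
def simplexHom {S T : SmSimplexCat (singSm d Y)} (f : SmSimplexHom S.left.dim T.left.dim)
    (h : ∀ x, (simplexMap T).1 (f.toFun x) = (simplexMap S).1 x) : S ⟶ T :=
  CostructuredArrow.homMk f <| (uliftYonedaEquiv.{u} (F := singSm d Y)).injective <| by
    have hf := uliftYonedaEquiv_naturality.{u} (F := singSm d Y) T.hom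
      (Quiver.Hom.op (X := S.left) (Y := T.left) f)
    rw [Quiver.Hom.unop_op] at hf
    exact hf.symm.trans (Subtype.ext (funext h))

theorem smSimplexCat_hom_ext {S T : SmSimplexCat (singSm d Y)} {f g : S ⟶ T}
    (h : ∀ x, SmSimplex.mapOf f.left x = SmSimplex.mapOf g.left x) : f = g :=
  CostructuredArrow.hom_ext _ _ (SmSimplexHom.ext (funext h))

theorem smoothOnSimplex_const {m n : ℕ} {M : Type*} [TopologicalSpace M]
    [ChartedSpace (EuclideanSpace ℝ (Fin n)) M] (y : M) :
    SmoothOnSimplex n (fun _ : Simplex m => y) := fun _ =>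
  ⟨univ, isOpen_univ, trivial, fun _ => y, contMDiffOn_const, fun _ _ => rfl⟩

/-- The point `y` of `Y`, as a simplex `Δ^0 → Y`. -/
noncomputable abbrev pointObj (d : ℕ) {Y : Type u} [TopologicalSpace Y]
    [ChartedSpace (EuclideanSpace ℝ (Fin d)) Y] (y : Y) : SmSimplexCat (singSm d Y) :=
  simplexObj (fun _ : Simplex 0 => y) (smoothOnSimplex_const y)

instance : Subsingleton (Simplex 0) := inferInstanceAs (Subsingleton (Subtype _))

/-- A point `x` of a simplex `S` over `y`, as a morphism of simplices of `Y`. -/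
noncomputable def pointHom (S : SmSimplexCat (singSm d Y)) (x : Simplex S.left.dim) {y : Y}
    (h : (simplexMap S).1 x = y) : pointObj d y ⟶ S :=
  simplexHom ⟨fun _ => x, smoothOnSimplex_const _⟩ fun z => by rw [simplexMap_simplexObj, h]

end SimplexCategory

/-! ### Simplices that parametrize open sets -/

/-- A smooth simplex in the `d`-manifold `Y` with a smooth right inverse on an open set. -/
structure SimplexChart (d : ℕ) (Y : Type u) [TopologicalSpace Y]
    [ChartedSpace (EuclideanSpace ℝ (Fin d)) Y] where
  /-- The smooth simplex. -/
  obj : SmSimplexCat (singSm d Y)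
  /-- The open set on which the inverse is defined. -/
  domain : Set Y
  isOpen_domain : IsOpen domain
  /-- The right inverse, with irrelevant values outside the domain. -/
  inv : Y → Simplex obj.left.dim
  smooth_inv : ContMDiffOn (𝓡 d) (𝓡 obj.left.dim) ∞ (fun y => simplexIncl _ (inv y)) domain
  right_inv : ∀ y ∈ domain, (simplexMap obj).1 (inv y) = y

namespace SimplexChart

variable {d : ℕ} {Y : Type u} [TopologicalSpace Y] [ChartedSpace (EuclideanSpace ℝ (Fin d)) Y]

theorem continuousOn_inv (C : SimplexChart d Y) : ContinuousOn C.inv C.domain :=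
  Topology.IsInducing.subtypeVal.continuousOn_iff.2 C.smooth_inv.continuousOn

theorem exists_mem_domain [IsManifold (𝓡 d) ∞ Y] (y : Y) :
    ∃ C : SimplexChart d Y, y ∈ C.domain := by
  classical
  set a := chartAt (EuclideanSpace ℝ (Fin d)) y
  obtain ⟨δ, hδ, hball⟩ := Metric.isOpen_iff.1 a.open_target (a y)
    (a.map_source (mem_chart_source _ _))
  obtain ⟨c, hc⟩ := Simplex.interior_nonempty (m := d)
  have hc' : c ∈ Simplex d := interior_subset hc
  -- `Δ^d` has diameter at most `2`, so that scaling by `δ / 4` sends it into the `δ`-ball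
  set r : ℝ := δ / 4 with hr
  have hr0 : 0 < r := by positivity
  set A : EuclideanSpace ℝ (Fin d) → EuclideanSpace ℝ (Fin d) := fun x => a y + r • (x - c)
    with hA
  set A' : EuclideanSpace ℝ (Fin d) → EuclideanSpace ℝ (Fin d) := fun z => c + r⁻¹ • (z - a y)
    with hA'
  have hAA' : ∀ z, A (A' z) = z := fun z => by
    simp [hA, hA', smul_smul, mul_inv_cancel₀ hr0.ne']
  have hAc : ContDiff ℝ ∞ A := by fun_prop
  have hA'c : ContDiff ℝ ∞ A' := by fun_prop
  have hmem : ∀ x : Simplex d, A x ∈ a.target := fun x => hball <| by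
    have := Simplex.norm_sub_le_two x ⟨c, hc'⟩
    rw [mem_ball_iff_norm]
    simp only [hA, add_sub_cancel_left, norm_smul, Real.norm_eq_abs, abs_of_pos hr0]
    nlinarith
  have hσ : SmoothOnSimplex d fun x : Simplex d => a.symm (A x) := fun x => by
    refine ⟨A ⁻¹' a.target, a.open_target.preimage hAc.continuous, hmem x, fun x => a.symm (A x),
      ?_, fun _ _ => rfl⟩
    exact (contMDiffOn_chart_symm (I := 𝓡 d) (n := ∞) (x := y)).comp
      hAc.contMDiff.contMDiffOn fun _ h => h
  refine ⟨⟨simplexObj _ hσ, a.source ∩ a ⁻¹' (A' ⁻¹' interior (Simplex d)),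
    a.isOpen_inter_preimage (isOpen_interior.preimage hA'c.continuous),
    fun z => if h : A' (a z) ∈ Simplex d then ⟨A' (a z), h⟩ else ⟨c, hc'⟩, ?_, ?_⟩, ?_⟩
  · have h1 : ContMDiffOn (𝓡 d) (𝓡 d) ∞ (fun z => A' (a z)) a.source :=
      hA'c.contMDiff.comp_contMDiffOn (contMDiffOn_chart (I := 𝓡 d) (n := ∞) (x := y))
    refine (h1.mono inter_subset_left).congr fun z hz => ?_
    rw [dif_pos (interior_subset hz.2)]
    rfl
  · intro z hz
    rw [dif_pos (interior_subset hz.2), simplexMap_simplexObj]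
    show a.symm (A (A' (a z))) = z
    rw [hAA', a.left_inv hz.1]
  · refine ⟨mem_chart_source _ _, ?_⟩
    simpa [hA'] using hc

end SimplexChart

/-- Postcomposition of a smooth simplex with a smooth map defined on an open set. -/
theorem SmoothOnSimplex.contMDiffOn_comp {m n d : ℕ} {M : Type*} [TopologicalSpace M]
    [ChartedSpace (EuclideanSpace ℝ (Fin d)) M] {M' : Type*} [TopologicalSpace M']
    [ChartedSpace (EuclideanSpace ℝ (Fin n)) M'] {σ : Simplex m → M} (hσ : SmoothOnSimplex d σ)
    {U : Set M} (hU : IsOpen U) {h : M → M'} (hh : ContMDiffOn (𝓡 d) (𝓡 n) ∞ h U)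
    (hσU : ∀ x, σ x ∈ U) : SmoothOnSimplex n fun x => h (σ x) := by
  intro x
  obtain ⟨W, hW, hxW, g, hg, hσg⟩ := hσ x
  refine ⟨W ∩ g ⁻¹' U, hg.continuousOn.isOpen_inter_preimage hW hU,
    ⟨hxW, by simpa only [mem_preimage, ← hσg x hxW] using hσU x⟩, fun y => h (g y),
    hh.comp (hg.mono inter_subset_left) fun y hy => hy.2,
    fun y hy => congrArg h (hσg y hy.1)⟩

/-! ### The fibres of a simplicial bundle over the points of the manifold -/

namespace SimplicialBundle

variable {E : Type v} [AddCommGroup E] [Module ℝ E] [TopologicalSpace E]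
  {G : Type w} [TopologicalSpace G] [ChartedSpace E G] [Group G]
  {d : ℕ} {Y : Type u} [TopologicalSpace Y] [ChartedSpace (EuclideanSpace ℝ (Fin d)) Y]
  (P : SimplicialBundle.{u, v, w, u'} E G (singSm d Y))

/-- The fibre over `y`: the total space of the bundle which `P` assigns to the `0`-simplex `y`. -/
def Fibre (y : Y) : Type u' := (P.obj (pointObj d y)).Total

noncomputable instance (y : Y) : MulAction Gᵐᵒᵖ (P.Fibre y) :=
  inferInstanceAs (MulAction Gᵐᵒᵖ (P.obj (pointObj d y)).Total)

instance (y : Y) : Nonempty (P.Fibre y) :=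
  let ⟨p, _⟩ := (P.obj (pointObj d y)).exists_proj_eq ⟨0, by simp [Simplex]⟩
  ⟨p⟩

theorem fibre_exists_smul_eq {y : Y} (p q : P.Fibre y) : ∃ g : G, MulOpposite.op g • p = q :=
  (P.obj (pointObj d y)).exists_smul_eq (Subsingleton.elim (α := Simplex 0) _ _)

/-- If `x` is a point of the simplex `S` over `y`, then the functoriality of `P` identifies the
fibre over `y` with the fibre of `P_S` over `x`. -/
noncomputable def transport (S : SmSimplexCat (singSm d Y)) (x : Simplex S.left.dim) {y : Y}
    (h : (simplexMap S).1 x = y) (p : P.Fibre y) : (P.obj S).Total :=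
  (P.map (pointHom S x h)).toFun p

variable {S T : SmSimplexCat (singSm d Y)} {x : Simplex S.left.dim} {y : Y}
  (h : (simplexMap S).1 x = y)

@[simp]
theorem proj_transport (p : P.Fibre y) : (P.obj S).proj (P.transport S x h p) = x :=
  (P.map (pointHom S x h)).proj_toFun p

theorem transport_smul (g : G) (p : P.Fibre y) :
    P.transport S x h (MulOpposite.op g • p) = MulOpposite.op g • P.transport S x h p :=
  (P.map (pointHom S x h)).map_smul g p

theorem map_transport (f : S ⟶ T) (p : P.Fibre y) :
    (P.map f).toFun (P.transport S x h p) =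
      P.transport T (SmSimplex.mapOf f.left x) ((simplexMap_comp f x).trans h) p :=
  (P.map_comp _ _ _).symm.trans
    (congrArg (fun k => (P.map k).toFun p) (smSimplexCat_hom_ext fun _ => rfl))

theorem transport_injective : Function.Injective (P.transport S x h) := by
  intro p q hpq
  obtain ⟨g, rfl⟩ := P.fibre_exists_smul_eq p q
  rw [transport_smul] at hpq
  have := (P.obj S).smul_left_injective (g := 1) (h := g) (by simpa using hpq)
  simp [← this]

theorem exists_transport_eq {q : (P.obj S).Total} (hq : (P.obj S).proj q = x) :
    ∃ p : P.Fibre y, P.transport S x h p = q := by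
  obtain ⟨p⟩ := (inferInstance : Nonempty (P.Fibre y))
  obtain ⟨g, hg⟩ := (P.obj S).exists_smul_eq (p := P.transport S x h p) (q := q)
    ((P.proj_transport h p).trans hq.symm)
  exact ⟨MulOpposite.op g • p, (P.transport_smul h g p).trans hg⟩

theorem coord_transport_smul {e : Bundle.Trivialization G (P.obj S).proj}
    (he : e ∈ (P.obj S).atlas) (hx : x ∈ e.baseSet) (g : G) (p : P.Fibre y) :
    (e (P.transport S x h (MulOpposite.op g • p))).2 = (e (P.transport S x h p)).2 * g := by
  rw [transport_smul, SmoothBundle.coord_smul he (by simpa using hx)]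

theorem exists_coord_transport_eq {e : Bundle.Trivialization G (P.obj S).proj}
    (hx : x ∈ e.baseSet) (g : G) : ∃ p : P.Fibre y,
      P.transport S x h p = e.toOpenPartialHomeomorph.symm (x, g) ∧
      (e (P.transport S x h p)).2 = g := by
  obtain ⟨p, hp⟩ := P.exists_transport_eq h (e.proj_symm_apply' hx (x := g))
  refine ⟨p, hp, ?_⟩
  rw [hp, e.apply_symm_apply' hx]

/-- A local trivialization of `P_S`, where `S` is a simplex which parametrizes an open set of
`Y`. -/
structure Frame extends SimplexChart d Y where
  /-- The local trivialization. -/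
  triv : Bundle.Trivialization G (P.obj obj).proj
  triv_mem : triv ∈ (P.obj obj).atlas

namespace Frame

variable {P} (F : P.Frame)

/-- The open set of `Y` over which a frame trivializes the fibres. -/
def baseSet : Set Y := F.domain ∩ F.inv ⁻¹' F.triv.baseSet

theorem isOpen_baseSet : IsOpen F.baseSet :=
  F.continuousOn_inv.isOpen_inter_preimage F.isOpen_domain F.triv.open_baseSet

theorem exists_mem_baseSet [IsManifold (𝓡 d) ∞ Y] (y : Y) : ∃ F : P.Frame, y ∈ F.baseSet := by
  obtain ⟨C, hC⟩ := SimplexChart.exists_mem_domain (d := d) y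
  obtain ⟨e, he, hy⟩ := (P.obj C.obj).exists_chart (C.inv y)
  exact ⟨⟨C, e, he⟩, hC, hy⟩

theorem map_inv {y : Y} (hy : y ∈ F.baseSet) : (simplexMap F.obj).1 (F.inv y) = y :=
  F.right_inv y hy.1

/-- The coordinate in `G` of a point of the fibre over `y`. -/
noncomputable def coord {y : Y} (hy : y ∈ F.baseSet) (p : P.Fibre y) : G :=
  (F.triv (P.transport F.obj (F.inv y) (F.map_inv hy) p)).2

theorem coord_smul {y : Y} (hy : y ∈ F.baseSet) (g : G) (p : P.Fibre y) :
    F.coord hy (MulOpposite.op g • p) = F.coord hy p * g :=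
  P.coord_transport_smul _ F.triv_mem hy.2 g p

theorem coord_injective {y : Y} (hy : y ∈ F.baseSet) : Function.Injective (F.coord hy) := by
  intro p q hpq
  obtain ⟨g, rfl⟩ := P.fibre_exists_smul_eq p q
  rw [coord_smul, left_eq_mul] at hpq
  simp [hpq]

theorem exists_coord_eq {y : Y} (hy : y ∈ F.baseSet) (g : G) :
    ∃ p : P.Fibre y, F.coord hy p = g := by
  obtain ⟨p, -, hp⟩ := P.exists_coord_transport_eq (F.map_inv hy) hy.2 g
  exact ⟨p, hp⟩

end Frame

/-- Every simplex becomes, after a sufficiently small contraction with a given centre, a simplex in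
a given open set. -/
theorem exists_contraction_mem (S : SmSimplexCat (singSm d Y)) (x : Simplex S.left.dim) {U : Set Y}
    (hU : IsOpen U) (hx : (simplexMap S).1 x ∈ U) :
    ∃ (ε : ℝ) (h0 : 0 < ε) (h1 : ε ≤ 1),
      ∀ z, (simplexMap S).1 ((Simplex.contraction x ε h0.le h1).toFun z) ∈ U := by
  obtain ⟨δ, hδ, hball⟩ := Metric.isOpen_iff.1 (hU.preimage (simplexMap S).2.continuous) x hx
  -- the diameter of the simplex is at most `2`
  refine ⟨min 1 (δ / 4), by positivity, min_le_left _ _, fun z => hball ?_⟩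
  have hz := Simplex.norm_sub_le_two z x
  have hε : min 1 (δ / 4) ≤ δ / 4 := min_le_right _ _
  have hε0 : 0 < min 1 (δ / 4) := by positivity
  rw [Metric.mem_ball, Subtype.dist_eq, dist_eq_norm]
  simp only [Simplex.contraction, add_sub_cancel_left, norm_smul, Real.norm_eq_abs,
    abs_of_pos hε0]
  nlinarith

variable [IsTopologicalAddGroup E] [ContinuousSMul ℝ E] [LocallyConvexSpace ℝ E] [T2Space E]
  [FrechetLieGroup E G]

/-- A local trivialization of `P_S` and a frame differ by a smooth function on the simplex. In a
neighbourhood of a point, the two are compared by means of a small contraction of `S` which factors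
through the simplex of the frame, since `P` turns both maps of simplices into smooth bundle maps. -/
theorem exists_smooth_comparison (S : SmSimplexCat (singSm d Y))
    {e : Bundle.Trivialization G (P.obj S).proj} (he : e ∈ (P.obj S).atlas) (F : P.Frame) :
    ∃ c : Simplex S.left.dim → G,
      SmoothAlong E S.left.dim (simplexIncl S.left.dim) c
        (e.baseSet ∩ (simplexMap S).1 ⁻¹' F.baseSet) ∧
      ∀ {x y} (hxy : (simplexMap S).1 x = y) (_ : x ∈ e.baseSet) (hy : y ∈ F.baseSet)
        (p : P.Fibre y), F.coord hy p = c x * (e (P.transport S x hxy p)).2 := by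
  -- pointwise, such a function exists because both coordinates are equivariant
  have hex : ∀ x, ∃ g : G, ∀ {y} (hxy : (simplexMap S).1 x = y) (_ : x ∈ e.baseSet)
      (hy : y ∈ F.baseSet) (p : P.Fibre y),
      F.coord hy p = g * (e (P.transport S x hxy p)).2 := by
    intro x
    by_cases hx : x ∈ e.baseSet ∧ (simplexMap S).1 x ∈ F.baseSet
    · obtain ⟨p₀, -, hp₀⟩ := P.exists_coord_transport_eq (y := (simplexMap S).1 x) rfl hx.1 1
      refine ⟨F.coord hx.2 p₀, ?_⟩
      rintro y rfl hxe hy p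
      obtain ⟨g, rfl⟩ := P.fibre_exists_smul_eq p₀ p
      rw [F.coord_smul, P.coord_transport_smul _ he hxe, hp₀, one_mul]
    · exact ⟨1, fun hxy hxe hy => absurd ⟨hxe, hxy ▸ hy⟩ hx⟩
  choose c hc using hex
  refine ⟨c, SmoothAlong.comp_of_local (n := S.left.dim) (ι := simplexIncl S.left.dim)
    fun x hx => ?_,
    fun hxy hxe hy p => hc _ hxy hxe hy p⟩
  obtain ⟨ε, h0, h1, hε⟩ := exists_contraction_mem S x F.isOpen_domain hx.2.1
  set f := Simplex.contraction x ε h0.le h1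
  have hσ : SmoothOnSimplex d fun z => (simplexMap S).1 (f.toFun z) :=
    (simplexMap S).2.comp f.smooth
  -- `R` is the contracted simplex; it maps to `S` by `f` and to the simplex of the frame by `h`
  set R := simplexObj _ hσ
  have hR : (simplexMap R).1 = fun z => (simplexMap S).1 (f.toFun z) := simplexMap_simplexObj _ hσ
  let f' : R ⟶ S := simplexHom f fun z => (congrFun hR z).symm
  let h : SmSimplexHom R.left.dim F.obj.left.dim :=
    ⟨fun z => F.inv ((simplexMap S).1 (f.toFun z)),
      hσ.contMDiffOn_comp F.isOpen_domain F.smooth_inv hε⟩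
  let h' : R ⟶ F.obj := simplexHom h fun z => (F.right_inv _ (hε z)).trans (congrFun hR z).symm
  obtain ⟨e', he', hxe'⟩ := (P.obj R).exists_chart x
  have ha := (P.map f').smooth e' he' e he
  have hb := (P.map h').smooth e' he' F.triv F.triv_mem
  have hab := (hb.mono (inter_subset_left (t := SmSimplex.mapOf f'.left ⁻¹' e.baseSet))).mul
    (ha.mono fun z hz => ⟨hz.1.1, hz.2⟩).inv
  -- the dilation `D` is inverse to `f`, and `φ` is its restriction to the simplex, with irrelevant
  -- values where `D` leaves the simplex
  obtain ⟨W, hW, hxW, hWmem⟩ := Simplex.exists_dilation_mem x h0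
  obtain ⟨O, hO, hOe⟩ := isOpen_induced_iff.1 e'.open_baseSet
  set D : EuclideanSpace ℝ (Fin S.left.dim) → EuclideanSpace ℝ (Fin S.left.dim) :=
    fun y => (x : EuclideanSpace ℝ (Fin S.left.dim)) + ε⁻¹ • (y - x) with hD
  have hDc : ContDiff ℝ ∞ D := by fun_prop
  classical
  let φ : Simplex S.left.dim → Simplex S.left.dim :=
    fun z => if hz : D z ∈ Simplex S.left.dim then ⟨D z, hz⟩ else x
  refine ⟨_, _, W ∩ D ⁻¹' O, D, φ, hab, hW.inter (hO.preimage hDc.continuous), ⟨hxW, ?_⟩,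
    hDc.contMDiff.contMDiffOn, ?_⟩
  · have : x ∈ Subtype.val ⁻¹' O := hOe ▸ hxe'
    simpa [hD, simplexIncl] using this
  · rintro z ⟨hze, hzF⟩ ⟨hzW, hzO⟩
    have hφ : φ z = ⟨D z, hWmem z hzW⟩ := dif_pos _
    have hfφ : f.toFun (φ z) = z := by
      rw [hφ]
      refine Subtype.ext ?_
      simp [f, hD, Simplex.contraction, smul_smul, mul_inv_cancel₀ h0.ne']
    have hφe : φ z ∈ e'.baseSet := by
      rw [← hOe, hφ]
      exact hzO
    have hfz : SmSimplex.mapOf f'.left (φ z) = z := hfφ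
    have hhz : SmSimplex.mapOf h'.left (φ z) = F.inv ((simplexMap S).1 z) := by
      show F.inv ((simplexMap S).1 (f.toFun (φ z))) = _
      rw [hfφ]
    refine ⟨⟨⟨hφe, ?_⟩, ?_⟩, congrArg Subtype.val hφ, ?_⟩
    · rw [mem_preimage, hhz]
      exact hzF.2
    · rwa [mem_preimage, hfz]
    · have hRz : (simplexMap R).1 (φ z) = (simplexMap S).1 z :=
        (congrFun hR _).trans (congrArg (simplexMap S).1 hfφ)
      obtain ⟨p, hp, -⟩ := P.exists_coord_transport_eq hRz hφe 1
      have h1 := P.map_transport hRz f' p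
      have h2 := P.map_transport hRz h' p
      rw [hp] at h1 h2
      have h3 := hc z rfl hze hzF p
      rw [h1, h2, eq_mul_inv_iff_mul_eq]
      simp only [hfz, hhz]
      exact h3.symm

end SimplicialBundle

/-! ### The bundle over the manifold glued from a simplicial bundle -/

namespace SimplicialBundle

variable {E : Type v} [AddCommGroup E] [Module ℝ E] [TopologicalSpace E]
  {G : Type w} [TopologicalSpace G] [ChartedSpace E G] [Group G]
  {d : ℕ} {Y : Type u} [TopologicalSpace Y] [ChartedSpace (EuclideanSpace ℝ (Fin d)) Y]
  (P : SimplicialBundle.{u, v, w, u'} E G (singSm d Y))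

/-- The disjoint union of the fibres of `P` over the points of `Y`. -/
abbrev GluedTotal : Type (max u u') := Bundle.TotalSpace G P.Fibre

noncomputable instance : MulAction Gᵐᵒᵖ P.GluedTotal where
  smul g z := ⟨z.1, g • z.2⟩
  one_smul z := congrArg (Bundle.TotalSpace.mk z.1) (one_smul _ z.2)
  mul_smul g h z := congrArg (Bundle.TotalSpace.mk z.1) (mul_smul g h z.2)

variable {P}

open Classical in
/-- The trivialization of the union of the fibres given by a frame, before the union is
topologized. Outside the base set the values are irrelevant. -/
noncomputable def Frame.pretriv (F : P.Frame) :
    Bundle.Pretrivialization G (Bundle.TotalSpace.proj : P.GluedTotal → Y) where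
  toFun z := (z.1, if hz : z.1 ∈ F.baseSet then F.coord hz z.2 else 1)
  invFun z := ⟨z.1, if hz : z.1 ∈ F.baseSet then (F.exists_coord_eq hz z.2).choose
    else Classical.arbitrary _⟩
  source := Bundle.TotalSpace.proj ⁻¹' F.baseSet
  target := F.baseSet ×ˢ univ
  map_source' z hz := ⟨hz, trivial⟩
  map_target' z hz := hz.1
  left_inv' := by
    rintro ⟨y, p⟩ hy
    have hy' : y ∈ F.baseSet := hy
    simp only [dif_pos hy']
    exact congrArg _ (F.coord_injective hy' (F.exists_coord_eq hy' _).choose_spec)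
  right_inv' := by
    rintro ⟨y, g⟩ ⟨hy, -⟩
    simp only [dif_pos hy]
    exact congrArg _ (F.exists_coord_eq hy g).choose_spec
  open_target := F.isOpen_baseSet.prod isOpen_univ
  baseSet := F.baseSet
  open_baseSet := F.isOpen_baseSet
  source_eq := rfl
  target_eq := rfl
  proj_toFun _ _ := rfl

theorem Frame.pretriv_apply (F : P.Frame) {y : Y} (hy : y ∈ F.baseSet) (p : P.Fibre y) :
    F.pretriv ⟨y, p⟩ = (y, F.coord hy p) :=
  congrArg (Prod.mk y) (dif_pos hy)

theorem Frame.exists_pretriv_symm (F : P.Frame) {y : Y} (hy : y ∈ F.baseSet) (g : G) :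
    ∃ p : P.Fibre y, F.coord hy p = g ∧ F.pretriv.toPartialEquiv.symm (y, g) = ⟨y, p⟩ :=
  ⟨_, (F.exists_coord_eq hy g).choose_spec, congrArg (Bundle.TotalSpace.mk y) (dif_pos hy)⟩

section Topology

variable (P) [IsManifold (𝓡 d) ∞ Y]

/-- A frame near a given point. -/
noncomputable def frameAt (y : Y) : P.Frame := (Frame.exists_mem_baseSet y).choose

theorem mem_baseSet_frameAt (y : Y) : y ∈ (P.frameAt y).baseSet :=
  (Frame.exists_mem_baseSet y).choose_spec

/-- The topology on the fibre for which the coordinate of a frame is a homeomorphism. It is needed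
only as a part of the data of a `FiberPrebundle`. -/
noncomputable instance (y : Y) : TopologicalSpace (P.Fibre y) :=
  .induced (fun p => (P.frameAt y).pretriv ⟨y, p⟩) inferInstance

end Topology

variable [IsTopologicalAddGroup E] [ContinuousSMul ℝ E] [LocallyConvexSpace ℝ E] [T2Space E]
  [FrechetLieGroup E G] [IsManifold (𝓡 d) ∞ Y]

/-- Two frames differ by a smooth function on the intersection of their domains. -/
theorem Frame.exists_smooth_transition (F F' : P.Frame) :
    ∃ c : Y → G, SmoothAlong E d (id : Y → Y) c (F.baseSet ∩ F'.baseSet) ∧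
      ∀ {y} (hy : y ∈ F.baseSet) (hy' : y ∈ F'.baseSet) (p : P.Fibre y),
        F'.coord hy' p = c y * F.coord hy p := by
  obtain ⟨c, hc, hcF⟩ := P.exists_smooth_comparison F.obj F.triv_mem F'
  refine ⟨fun y => c (F.inv y), SmoothAlong.comp_of_local (n := F.obj.left.dim)
    (ι := simplexIncl F.obj.left.dim) fun y hy => ⟨c, _, F.domain, _, F.inv, hc, F.isOpen_domain,
      hy.1.1, F.smooth_inv, fun z hz _ => ⟨⟨hz.1.2, ?_⟩, rfl, rfl⟩⟩,
    fun hy hy' p => hcF (F.map_inv hy) hy.2 hy' p⟩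
  rw [mem_preimage, F.map_inv hz.1]
  exact hz.2

variable (P)

/-- The frames define a topology on the union of the fibres. -/
noncomputable def prebundle : FiberPrebundle G P.Fibre where
  pretrivializationAtlas := range Frame.pretriv
  pretrivializationAt y := (P.frameAt y).pretriv
  mem_base_pretrivializationAt := P.mem_baseSet_frameAt
  pretrivialization_mem_atlas y := ⟨_, rfl⟩
  continuous_trivChange := by
    rintro _ ⟨F', rfl⟩ _ ⟨F, rfl⟩
    have : IsTopologicalGroup G := FrechetLieGroup.toIsTopologicalGroup (E := E)
    obtain ⟨c, hc, hcF⟩ := F.exists_smooth_transition F'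
    have hcc : ContinuousOn (fun z : Y × G => (z.1, c z.1 * z.2))
        ((F.baseSet ∩ F'.baseSet) ×ˢ univ) :=
      continuousOn_fst.prodMk (((hc.continuousOn continuous_id).comp continuousOn_fst
        fun z hz => hz.1).mul continuousOn_snd)
    have key : ∀ z ∈ F.pretriv.target ∩ F.pretriv.toPartialEquiv.symm ⁻¹' F'.pretriv.source,
        z ∈ (F.baseSet ∩ F'.baseSet) ×ˢ (univ : Set G) ∧
          (F'.pretriv ∘ F.pretriv.toPartialEquiv.symm) z = (z.1, c z.1 * z.2) := by
      rintro ⟨y, g⟩ ⟨⟨hy, -⟩, hy'⟩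
      replace hy : y ∈ F.baseSet := hy
      obtain ⟨p, hp, hyp⟩ := F.exists_pretriv_symm hy g
      rw [mem_preimage, hyp] at hy'
      replace hy' : y ∈ F'.baseSet := hy'
      refine ⟨⟨⟨hy, hy'⟩, trivial⟩, ?_⟩
      rw [Function.comp_apply, hyp, F'.pretriv_apply hy', hcF hy hy' p, hp]
    exact (hcc.mono fun z hz => (key z hz).1).congr fun z hz => (key z hz).2
  totalSpaceMk_isInducing _ := ⟨rfl⟩

noncomputable instance : TopologicalSpace P.GluedTotal := P.prebundle.totalSpaceTopology

variable {P}

/-- The local trivialization of the glued bundle given by a frame. -/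
noncomputable def Frame.gluedTriv (F : P.Frame) :
    Bundle.Trivialization G (Bundle.TotalSpace.proj : P.GluedTotal → Y) :=
  P.prebundle.trivializationOfMemPretrivializationAtlas (e := F.pretriv) ⟨F, rfl⟩

theorem Frame.gluedTriv_apply (F : P.Frame) {y : Y} (hy : y ∈ F.baseSet) (p : P.Fibre y) :
    F.gluedTriv ⟨y, p⟩ = (y, F.coord hy p) :=
  F.pretriv_apply hy p

theorem Frame.exists_gluedTriv_symm (F : P.Frame) {y : Y} (hy : y ∈ F.baseSet) (g : G) :
    ∃ p : P.Fibre y, F.coord hy p = g ∧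
      F.gluedTriv.toOpenPartialHomeomorph.symm (y, g) = ⟨y, p⟩ :=
  F.exists_pretriv_symm hy g

variable (P)

/-- The smooth principal bundle over `Y` whose fibre over `y` is the total space of the bundle which
`P` assigns to the `0`-simplex `y`. -/
noncomputable def gluedBundle : ManifoldBundle.{u, v, w, max u u'} E G d Y where
  Total := P.GluedTotal
  proj := Bundle.TotalSpace.proj
  atlas := range Frame.gluedTriv
  exists_chart y := ⟨_, ⟨P.frameAt y, rfl⟩, P.mem_baseSet_frameAt y⟩
  proj_smul _ _ := rfl
  equivariant := by
    rintro _ ⟨F, rfl⟩ ⟨y, p⟩ hy g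
    replace hy : y ∈ F.baseSet := hy
    rw [F.gluedTriv_apply hy]
    refine (F.gluedTriv_apply hy (MulOpposite.op g • p)).trans ?_
    rw [F.coord_smul]
  smooth_transition := by
    rintro _ ⟨F, rfl⟩ _ ⟨F', rfl⟩
    obtain ⟨c, hc, hcF⟩ := F.exists_smooth_transition F'
    refine hc.congr fun y hy => ?_
    have hyF : y ∈ F.baseSet := hy.1
    have hyF' : y ∈ F'.baseSet := hy.2
    obtain ⟨p, hp, hyp⟩ := F.exists_gluedTriv_symm hyF 1
    simp only [hyp]
    rw [F'.gluedTriv_apply hyF', hcF hyF hyF', hp, mul_one]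

/-! ### The isomorphism with the given simplicial bundle -/

/-- The isomorphism from the simplicial bundle induced by the glued bundle: on the fibre over a
point `x` of a simplex it is the transport along `x`. -/
noncomputable def gluedHom : SimplicialBundleMap (inducedBundle P.gluedBundle) P where
  app S :=
    { toFun := fun z => P.transport S z.1.1 z.2 z.1.2.2
      proj_toFun := fun z => P.proj_transport z.2 z.1.2.2
      map_smul := fun g z => P.transport_smul z.2 g z.1.2.2
      smooth := by
        rintro _ ⟨_, ⟨F, rfl⟩, rfl⟩ e he
        obtain ⟨c, hc, hcF⟩ := P.exists_smooth_comparison S he F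
        refine (hc.mono fun x hx => ⟨hx.2, hx.1⟩).inv.congr fun x hx => ?_
        have hxF : (simplexMap S).1 x ∈ F.baseSet := hx.1
        have hxe : x ∈ e.baseSet := hx.2
        obtain ⟨p, hp, hyp⟩ := F.exists_gluedTriv_symm hxF 1
        have h := pullbackTriv_symm_apply P.gluedBundle (simplexMap S).2.continuous F.gluedTriv
          hx.1 1
        have hz : (pullbackTriv P.gluedBundle (simplexMap S).2.continuous
            F.gluedTriv).toOpenPartialHomeomorph.symm (x, 1) = ⟨(x, ⟨_, p⟩), rfl⟩ :=
          Subtype.ext (h.trans (congrArg (Prod.mk x) hyp))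
        have h1 := hcF rfl hxe hxF p
        rw [hp] at h1
        exact (congrArg (fun z : PullbackTotal P.gluedBundle (simplexMap S).1 =>
          (e (P.transport S z.1.1 z.2 z.1.2.2)).2) hz).trans
            (eq_inv_of_mul_eq_one_right h1.symm) }
  naturality f z := (P.map_transport z.2 f z.1.2.2).symm

theorem exists_gluedHom_eq (S : SmSimplexCat (singSm d Y)) (q : (P.obj S).Total) :
    ∃ z : ((inducedBundle P.gluedBundle).obj S).Total, (P.gluedHom.app S).toFun z = q := by
  obtain ⟨p, hp⟩ := P.exists_transport_eq (y := (simplexMap S).1 ((P.obj S).proj q)) rfl rfl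
  exact ⟨⟨((P.obj S).proj q, ⟨_, p⟩), rfl⟩, hp⟩

theorem gluedHom_injective (S : SmSimplexCat (singSm d Y)) :
    Function.Injective (P.gluedHom.app S).toFun := by
  rintro ⟨⟨x, ⟨y, p⟩⟩, h⟩ ⟨⟨x', ⟨y', p'⟩⟩, h'⟩ hpp
  obtain rfl : x = x' := ((P.gluedHom.app S).proj_toFun _).symm.trans
    ((congrArg (P.obj S).proj hpp).trans ((P.gluedHom.app S).proj_toFun _))
  change (simplexMap S).1 x = y at h
  change (simplexMap S).1 x = y' at h'
  obtain rfl : y = y' := h.symm.trans h'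
  obtain rfl : p = p' := P.transport_injective h hpp
  rfl

/-- The inverse of the isomorphism `gluedHom`. -/
noncomputable def gluedInv : SimplicialBundleMap P (inducedBundle P.gluedBundle) where
  app S :=
    { toFun := fun q => (P.exists_gluedHom_eq S q).choose
      proj_toFun := fun q => ((P.gluedHom.app S).proj_toFun _).symm.trans
        (congrArg (P.obj S).proj (P.exists_gluedHom_eq S q).choose_spec)
      map_smul := fun g q => P.gluedHom_injective S <| by
        rw [(P.gluedHom.app S).map_smul, (P.exists_gluedHom_eq S q).choose_spec,
          (P.exists_gluedHom_eq S _).choose_spec]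
      smooth := by
        rintro e he _ ⟨_, ⟨F, rfl⟩, rfl⟩
        obtain ⟨c, hc, hcF⟩ := P.exists_smooth_comparison S he F
        refine hc.congr fun x hx => ?_
        have hxF : (simplexMap S).1 x ∈ F.baseSet := hx.2
        have hxe : x ∈ e.baseSet := hx.1
        obtain ⟨p, hp, hp1⟩ := P.exists_coord_transport_eq (y := (simplexMap S).1 x) rfl hxe 1
        have hz : (P.exists_gluedHom_eq S (e.toOpenPartialHomeomorph.symm (x, 1))).choose =
            ⟨(x, ⟨_, p⟩), rfl⟩ :=
          P.gluedHom_injective S ((P.exists_gluedHom_eq S _).choose_spec.trans hp.symm)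
        have h1 := hcF rfl hxe hxF p
        rw [hp1, mul_one] at h1
        simp only [hz]
        exact (congrArg Prod.snd (F.gluedTriv_apply hxF p)).trans h1 }
  naturality {S T} f q := P.gluedHom_injective T <| by
    rw [(P.exists_gluedHom_eq T _).choose_spec, P.gluedHom.naturality,
      (P.exists_gluedHom_eq S q).choose_spec]

end SimplicialBundle

theorem mainTheorem8 {E : Type v} [AddCommGroup E] [Module ℝ E] [UniformSpace E]
    [IsUniformAddGroup E] [ContinuousSMul ℝ E] [LocallyConvexSpace ℝ E] [T2Space E]
    [CompleteSpace E]
    {G : Type w} [TopologicalSpace G] [ChartedSpace E G] [Group G] [FrechetLieGroup E G]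
    {d : ℕ} {Y : Type u} [TopologicalSpace Y] [ChartedSpace (EuclideanSpace ℝ (Fin d)) Y]
    [IsManifold (𝓡 d) ∞ Y]
    (P : SimplicialBundle.{u, v, w, u'} E G (singSm d Y)) :
    ∃ N : ManifoldBundle.{u, v, w, max u u'} E G d Y, P.InducibleBy N :=
  ⟨P.gluedBundle, P.gluedHom, P.gluedInv,
    fun S _ => P.gluedHom_injective S (P.exists_gluedHom_eq S _).choose_spec,
    fun S q => (P.exists_gluedHom_eq S q).choose_spec⟩
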